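/- Let $K$ be a product formula field, that is, a field with a family $\Omega_K$ of (suitably normalized) absolute values, all but finitely many of them nonarchimedean, such that every $x\in K^*$ satisfies $|x|_v=1$ for all but finitely many $v\in\Omega_K$ and $\prod_{v\in\Omega_K}|x|_v=1$ (absolute values are counted with multiplicity). Examples are number fields, and function fields of finite transcendence degree over a field $F$ with the absolute values attached to the prime divisors of a projective model. Let $\bar K$ be an algebraic closure of $K$, and extend each $|\cdot|_v$ to $\bar K$. The Weil height of $Q=[x_0:\cdots:x_m]\in\mathbb P^m(\bar K)$ is $$h(Q)=\frac1{N_L}\sum_{v\in\Omega_K}\ \sum_{\sigma:L\hookrightarrow\bar K,\ \sigma|_K=\mathrm{id}}\log\max_i|\sigma(x_i)|_v,$$ where $L$ is a finite extension of $K$ in $\bar K$ containing the $x_i$ and $N_L$ is the number of embeddings $\sigma$ (so $N_L=[L:K]$ when $L/K$ is separable). For $\lambda\in\mathbb A^m(\bar K)$ put $h(\lambda)=h([\lambda_m:\cdots:\lambda_1:1])$. On $\mathbb P^m(\bar K(t_1,\dots,t_m))$, $h$ denotes the height of the function field $\bar K(t_1,\dots,t_m)$ given by the prime divisors of $\mathbb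 P^m$ over $\bar K$; for a point with coprime polynomial coordinates it is the maximum of their total degrees. Let $m\ge 2$, and let $c_1,\dots,c_m\in\bar K$ be distinct. Let $P=[c_m:\cdots:c_1:1]$. For $d>m$ put $f_t(z)=z^d+t_1z^{m-1}+\cdots+t_{m-1}z+t_m$ and let $\Phi$ be the endomorphism $$\Phi([X_m:\cdots:X_1:X_0])=\bigl[X_0^df_t(X_m/X_0):\cdots:X_0^df_t(X_1/X_0):X_0^d\bigr]$$ of $\mathbb P^m$ over $\bar K(t_1,\dots,t_m)$, where $t_1,\dots,t_m$ are independent variables. For $\lambda=(\lambda_1,\dots,\lambda_m)\in\mathbb A^m(\bar K)$ let $\Phi_\lambda$ be its specialization at $t=\lambda$, an endomorphism of $\mathbb P^m$ over $\bar K$. Then there is a constant $C$, depending only on $c_1,\dots,c_m$ (and on $K$ with its absolute values), such that for every integer $d>m$ and every $\lambda\in\mathbb A^m(\bar K)$ the limits $$\hat h_{\Phi}(P)=\lim_{n\to\infty}\frac{h(\Phi^n(P))}{d^n},\qquad \hat h_{\Phi_\lambda}(P)=\lim_{n\to\infty}\frac{h(\Phi_\lambda^n(P))}{d^n}$$ exist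 and $$\bigl|\hat h_{\Phi_\lambda}(P)-\hat h_\Phi(P)\cdot h(\lambda)\bigr|\le C .$$ -/

import Mathlib

open Filter Topology
open scoped NNReal

universe u v w

noncomputable section

namespace SpecializationHeight

/-! ### Extending absolute values to an algebraic closure, and the Weil height -/

section Weil

variable (K : Type u) (Kbar : Type v) [Field K] [Field Kbar] [Algebra K Kbar]

open Classical in
/-- A fixed extension of the absolute value `v` of `K` to the algebraic closure of `K`.
Such an extension always exists; the trivial absolute value is only a formal default. -/
def extendAbs (v : AbsoluteValue K ℝ) : AbsoluteValue Kbar ℝ :=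
  if h : ∃ w : AbsoluteValue Kbar ℝ, ∀ a : K, w (algebraMap K Kbar a) = v a then h.choose
  else AbsoluteValue.trivial

variable {K Kbar}

/-- The contribution of the place `v` to the height of a tuple `x` of elements of the finite
extension `L` of `K`: the sum over all `K`-embeddings `σ` of `L` into the algebraic closure
of `log maxᵢ |σ xᵢ|ᵥ`. -/
def localHeight (L : IntermediateField K Kbar) {ι : Type w} (x : ι → L)
    (v : AbsoluteValue K ℝ) : ℝ :=
  ∑ᶠ σ : L →ₐ[K] Kbar, Real.log (⨆ i, extendAbs K Kbar v (σ (x i)))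

variable [Height.AdmissibleAbsValues K]

open Height.AdmissibleAbsValues in
/-- The sum of the local contributions over all places of `K` (archimedean places are listed with
their multiplicity, the weights of the nonarchimedean places are part of the normalization of the
absolute values), divided by the number of `K`-embeddings of `L`, which is the degree of `L/K` in
the separable case and its separable degree in general. -/
def weilHeightOver (L : IntermediateField K Kbar) {ι : Type w} (x : ι → L) : ℝ :=
  (Nat.card (L →ₐ[K] Kbar) : ℝ)⁻¹ *
    (((archAbsVal (K := K)).map (localHeight L x)).sum +
      ∑ᶠ v : nonarchAbsVal (K := K), localHeight L x v.val)

variable (K)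

/-- The field generated over `K` by the entries of a tuple. -/
def fieldOf {ι : Type w} (x : ι → Kbar) : IntermediateField K Kbar :=
  IntermediateField.adjoin K (Set.range x)

/-- The Weil height (relative to `K`) of a tuple of homogeneous coordinates in the algebraic
closure of `K`, computed over the field generated by the coordinates. -/
def weilHeightTuple {ι : Type w} (x : ι → Kbar) : ℝ :=
  weilHeightOver (fieldOf K x)
    (fun i ↦ (⟨x i, IntermediateField.subset_adjoin K _ ⟨i, rfl⟩⟩ : fieldOf K x))

end Weil

section Projective

variable {k : Type u} [Field k] {m : ℕ}

/-- The projective space `ℙ^m(k)`; the coordinate with index `i` is the homogeneous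
coordinate `X_i`, for `0 ≤ i ≤ m`. -/
abbrev ProjSpace (k : Type u) [Field k] (m : ℕ) : Type u :=
  Projectivization k (Fin (m + 1) → k)

lemma exists_rep_ne_zero (P : ProjSpace k m) : ∃ i, P.rep i ≠ 0 :=
  Function.ne_iff.mp P.rep_nonzero

open Classical in
/-- The homogeneous coordinates of a point of `ℙ^m` whose first nonzero entry is `1`. -/
def normalizedCoords (P : ProjSpace k m) : Fin (m + 1) → k :=
  (P.rep (Fin.find (fun i ↦ P.rep i ≠ 0) (exists_rep_ne_zero P)))⁻¹ • P.rep

lemma mk_normalizedCoords (P : ProjSpace k m) :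
    ∃ h : normalizedCoords P ≠ 0, Projectivization.mk k (normalizedCoords P) h = P := by
  classical
  have hi : P.rep (Fin.find (fun i ↦ P.rep i ≠ 0) (exists_rep_ne_zero P)) ≠ 0 :=
    Fin.find_spec (exists_rep_ne_zero P)
  have h : normalizedCoords P ≠ 0 := smul_ne_zero (inv_ne_zero hi) P.rep_nonzero
  refine ⟨h, ?_⟩
  conv_rhs => rw [← P.mk_rep]
  exact (Projectivization.mk_eq_mk_iff' _ _ _ _ _).2 ⟨_, rfl⟩

/-- The Weil height of a point of `ℙ^m` over the algebraic closure of `K`. By the product formula,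
the value does not depend on the choice of homogeneous coordinates. -/
def weilHeight (K : Type u) {Kbar : Type v} [Field K] [Field Kbar] [Algebra K Kbar]
    [Height.AdmissibleAbsValues K] (P : ProjSpace Kbar m) : ℝ :=
  weilHeightTuple K (normalizedCoords P)

lemma cons_one_ne_zero (a : Fin m → k) : (Fin.cons 1 a : Fin (m + 1) → k) ≠ 0 :=
  fun h ↦ one_ne_zero (α := k) (by simpa using congrFun h 0)

/-- The point `[a_m : ⋯ : a_1 : 1]` of `ℙ^m` attached to the point `a` of `𝔸^m`; the entry `a j`
(with `j` starting at `0`) is the value of the coordinate `X_{j+1}`. -/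
def affinePoint (a : Fin m → k) : ProjSpace k m :=
  Projectivization.mk k (Fin.cons 1 a) (cons_one_ne_zero a)

/-! ### The family of endomorphisms -/

/-- The polynomial `z^d + t_1 z^(m-1) + ⋯ + t_(m-1) z + t_m`, where `t_(j+1)` is `t j`. -/
def family (d : ℕ) (t : Fin m → k) : Polynomial k :=
  Polynomial.X ^ d + ∑ j : Fin m, Polynomial.C (t j) * Polynomial.X ^ (m - 1 - (j : ℕ))

/-- The homogenization `x^d + ∑ⱼ t_j x^(m-j) x₀^(d-m+j)` of `family d t`. -/
def familyHom (d : ℕ) (t : Fin m → k) (x x₀ : k) : k :=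
  x ^ d + ∑ j : Fin m, t j * x ^ (m - 1 - (j : ℕ)) * x₀ ^ (d - (m - 1 - (j : ℕ)))

lemma familyHom_eq {d : ℕ} (hd : m < d) (t : Fin m → k) (x x₀ : k) (h : x₀ ≠ 0) :
    familyHom d t x x₀ = x₀ ^ d * (family d t).eval (x / x₀) := by
  simp only [familyHom, family, Polynomial.eval_add, Polynomial.eval_pow, Polynomial.eval_X,
    Polynomial.eval_finsetSum, Polynomial.eval_mul, Polynomial.eval_C, mul_add, Finset.mul_sum]
  congr 1
  · rw [div_pow]
    field_simp
  · refine Finset.sum_congr rfl fun j _ ↦ ?_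
    have : x₀ ^ d = x₀ ^ (m - 1 - (j : ℕ)) * x₀ ^ (d - (m - 1 - (j : ℕ))) := by
      rw [← pow_add]; congr 1; omega
    rw [this, div_pow]
    field_simp

lemma familyHom_zero {d : ℕ} (hd : m < d) (t : Fin m → k) (x : k) :
    familyHom d t x 0 = x ^ d := by
  have : ∀ j : Fin m, d - (m - 1 - (j : ℕ)) ≠ 0 := fun j ↦ by omega
  simp [familyHom, this]

lemma familyHom_smul {d : ℕ} (hd : m < d) (t : Fin m → k) (a x x₀ : k) :
    familyHom d t (a * x) (a * x₀) = a ^ d * familyHom d t x x₀ := by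
  simp only [familyHom, mul_add, Finset.mul_sum, mul_pow]
  congr 1
  refine Finset.sum_congr rfl fun j _ ↦ ?_
  have : a ^ d = a ^ (m - 1 - (j : ℕ)) * a ^ (d - (m - 1 - (j : ℕ))) := by
    rw [← pow_add]; congr 1; omega
  rw [this]
  ring

/-- The map `(X_0, X_1, …, X_m) ↦ (X_0^d, X_0^d f(X_1/X_0), …, X_0^d f(X_m/X_0))` on homogeneous
coordinates, where `f = family d t`. -/
def liftedMap (d : ℕ) (t : Fin m → k) (x : Fin (m + 1) → k) : Fin (m + 1) → k :=
  Fin.cons (x 0 ^ d) fun i : Fin m ↦ familyHom d t (x i.succ) (x 0)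

lemma liftedMap_ne_zero {d : ℕ} (hd : m < d) (t : Fin m → k) {x : Fin (m + 1) → k}
    (hx : x ≠ 0) : liftedMap d t x ≠ 0 := by
  intro h
  have h0 : x 0 = 0 := by
    have := congrFun h 0
    simp only [liftedMap, Fin.cons_zero, Pi.zero_apply] at this
    exact eq_zero_of_pow_eq_zero this
  refine hx (funext fun i ↦ Fin.cases h0 (fun j ↦ ?_) i)
  have := congrFun h j.succ
  simp only [liftedMap, Fin.cons_succ, Pi.zero_apply, h0, familyHom_zero hd] at this
  exact eq_zero_of_pow_eq_zero this

lemma liftedMap_smul {d : ℕ} (hd : m < d) (t : Fin m → k) (a : k) (x : Fin (m + 1) → k) :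
    liftedMap d t (a • x) = a ^ d • liftedMap d t x := by
  funext i
  refine Fin.cases ?_ (fun j ↦ ?_) i
  · simp [liftedMap, mul_pow]
  · simp [liftedMap, familyHom_smul hd]

/-- The endomorphism `Φ_t` of `ℙ^m` which is `f × ⋯ × f` on `𝔸^m`, with `f = family d t`. -/
def familyMap {d : ℕ} (hd : m < d) (t : Fin m → k) (P : ProjSpace k m) : ProjSpace k m :=
  Projectivization.lift
    (fun x : {x : Fin (m + 1) → k // x ≠ 0} ↦
      Projectivization.mk k (liftedMap d t x.val) (liftedMap_ne_zero hd t x.property))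
    (fun a b s h ↦ by
      refine (Projectivization.mk_eq_mk_iff' _ _ _ _ _).2 ⟨s ^ d, ?_⟩
      rw [h, liftedMap_smul hd])
    P

/-- The canonical height `lim h(fⁿ(x)) / dⁿ` of the point `x` with respect to a self-map `f` of
degree `d` and the height function `h`. -/
def canonicalHeight {X : Type u} (h : X → ℝ) (d : ℕ) (f : X → X) (x : X) : ℝ :=
  limUnder atTop fun n : ℕ ↦ h (f^[n] x) / (d : ℝ) ^ n

/-- The limit that defines the canonical height exists. -/
def CanonicalHeightConverges {X : Type u} (h : X → ℝ) (d : ℕ) (f : X → X) (x : X) : Prop :=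
  Tendsto (fun n : ℕ ↦ h (f^[n] x) / (d : ℝ) ^ n) atTop (𝓝 (canonicalHeight h d f x))

end Projective

/-! ### The rational function field `F(t_1, …, t_m)` as a product formula field

The absolute values are those attached to the prime divisors of the projective space `ℙ^m` over
`F`: the `p`-adic ones `exp (-(deg p) ord_p)`, for `p` an irreducible polynomial, and the one
attached to the hyperplane at infinity, `exp (deg)`, where `deg` is the total degree. -/

section FunctionField

/-- A valuation on a domain, given by its logarithm on nonzero elements. -/
def expValuation {R : Type u} [CommRing R] [IsDomain R] (φ : R → ℝ) (h_one : φ 1 = 0)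
    (h_mul : ∀ a b, a ≠ 0 → b ≠ 0 → φ (a * b) = φ a + φ b)
    (h_add : ∀ a b, a ≠ 0 → b ≠ 0 → a + b ≠ 0 → φ (a + b) ≤ max (φ a) (φ b)) :
    Valuation R ℝ≥0 := by
  classical
  exact
  { toFun := fun a ↦ if a = 0 then 0 else Real.toNNReal (Real.exp (φ a))
    map_zero' := by simp
    map_one' := by simp [h_one]
    map_mul' := fun a b ↦ by
      by_cases ha : a = 0
      · simp [ha]
      by_cases hb : b = 0
      · simp [hb]
      simp only [ha, hb, mul_eq_zero, or_self, if_false]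
      rw [h_mul a b ha hb, Real.exp_add, Real.toNNReal_mul (Real.exp_pos _).le]
    map_add_le_max' := fun a b ↦ by
      by_cases ha : a = 0
      · simp [ha]
      by_cases hb : b = 0
      · simp [hb]
      by_cases hab : a + b = 0
      · simp [hab]
      simp only [ha, hb, hab, if_false]
      rcases le_max_iff.1 (h_add a b ha hb hab) with h | h
      · exact le_max_of_le_left (Real.toNNReal_le_toNNReal (Real.exp_le_exp.2 h))
      · exact le_max_of_le_right (Real.toNNReal_le_toNNReal (Real.exp_le_exp.2 h)) }

lemma expValuation_apply {R : Type u} [CommRing R] [IsDomain R] {φ : R → ℝ} {h1 h2 h3}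
    {a : R} (ha : a ≠ 0) : ((expValuation φ h1 h2 h3 a : ℝ≥0) : ℝ) = Real.exp (φ a) := by
  have : expValuation φ h1 h2 h3 a = Real.toNNReal (Real.exp (φ a)) := if_neg ha
  rw [this, Real.coe_toNNReal _ (Real.exp_pos _).le]

lemma expValuation_le {R : Type u} [CommRing R] [IsDomain R] (φ : R → ℝ) (h1 h2 h3) :
    nonZeroDivisors R ≤ (expValuation φ h1 h2 h3).supp.primeCompl := by
  intro a ha h
  have ha' : a ≠ 0 := nonZeroDivisors.ne_zero ha
  have h' : expValuation φ h1 h2 h3 a = 0 := (Valuation.mem_supp_iff _ _).1 h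
  have := expValuation_apply (h1 := h1) (h2 := h2) (h3 := h3) ha'
  rw [h'] at this
  exact (Real.exp_pos (φ a)).ne (by simpa using this)

/-- The absolute value on the fraction field of a domain, given by its logarithm on the nonzero
elements of the domain. -/
def expAbs {R : Type u} [CommRing R] [IsDomain R] (φ : R → ℝ) (h1 : φ 1 = 0)
    (h2 : ∀ a b, a ≠ 0 → b ≠ 0 → φ (a * b) = φ a + φ b)
    (h3 : ∀ a b, a ≠ 0 → b ≠ 0 → a + b ≠ 0 → φ (a + b) ≤ max (φ a) (φ b)) :
    AbsoluteValue (FractionRing R) ℝ where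
  toFun x := ((expValuation φ h1 h2 h3).extendToLocalization (expValuation_le φ h1 h2 h3)
    (FractionRing R) x : ℝ≥0)
  map_mul' x y := by simp
  nonneg' x := NNReal.coe_nonneg _
  eq_zero' x := by simp
  add_le' x y := by
    have := ((expValuation φ h1 h2 h3).extendToLocalization (expValuation_le φ h1 h2 h3)
      (FractionRing R)).map_add x y
    exact_mod_cast this.trans (max_le_add_of_nonneg zero_le zero_le)

lemma expAbs_isNonarchimedean {R : Type u} [CommRing R] [IsDomain R] (φ : R → ℝ) (h1 h2 h3) :
    IsNonarchimedean (expAbs φ h1 h2 h3) := fun x y ↦ by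
  have := ((expValuation φ h1 h2 h3).extendToLocalization (expValuation_le φ h1 h2 h3)
      (FractionRing R)).map_add x y
  exact_mod_cast this

lemma expAbs_algebraMap {R : Type u} [CommRing R] [IsDomain R] {φ : R → ℝ} {h1 h2 h3}
    {a : R} (ha : a ≠ 0) :
    expAbs φ h1 h2 h3 (algebraMap R (FractionRing R) a) = Real.exp (φ a) := by
  rw [← expValuation_apply (h1 := h1) (h2 := h2) (h3 := h3) ha]
  change (((expValuation φ h1 h2 h3).extendToLocalization
    (expValuation_le φ h1 h2 h3) (FractionRing R) (algebraMap R (FractionRing R) a) : ℝ≥0) : ℝ) = _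
  rw [Valuation.extendToLocalization_apply_map_apply]

variable (F : Type u) [Field F] (ι : Type v)

/-- The field `F(t_i : i ∈ ι)` of rational functions. -/
abbrev RationalFunctions : Type (max u v) := FractionRing (MvPolynomial ι F)

variable {F ι}

/-- The absolute value `exp (-(deg p) ord_p)` for an irreducible polynomial `p`. -/
def primeAbs (p : MvPolynomial ι F) (hp : Irreducible p) :
    AbsoluteValue (RationalFunctions F ι) ℝ :=
  expAbs (fun a ↦ -((p.totalDegree : ℝ) * (multiplicity p a : ℝ)))
    (by
      have : multiplicity p 1 = 0 :=
        multiplicity_eq_zero.2 fun h ↦ hp.not_isUnit (isUnit_of_dvd_one h)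
      simp [this])
    (fun a b ha hb ↦ by
      rw [multiplicity_mul hp.prime
        (FiniteMultiplicity.of_not_isUnit hp.not_isUnit (mul_ne_zero ha hb))]
      push_cast
      ring)
    (fun a b ha hb hab ↦ by
      have fin : ∀ {c : MvPolynomial ι F}, c ≠ 0 → FiniteMultiplicity p c :=
        fun hc ↦ FiniteMultiplicity.of_not_isUnit hp.not_isUnit hc
      have h : min (emultiplicity p a) (emultiplicity p b) ≤ emultiplicity p (a + b) :=
        min_le_emultiplicity_add
      rw [(fin ha).emultiplicity_eq_multiplicity, (fin hb).emultiplicity_eq_multiplicity,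
        (fin hab).emultiplicity_eq_multiplicity] at h
      rcases min_le_iff.1 h with h'' | h''
      · refine le_max_of_le_left (neg_le_neg (mul_le_mul_of_nonneg_left ?_ (Nat.cast_nonneg _)))
        exact_mod_cast h''
      · refine le_max_of_le_right (neg_le_neg (mul_le_mul_of_nonneg_left ?_ (Nat.cast_nonneg _)))
        exact_mod_cast h'')

lemma primeAbs_algebraMap {p : MvPolynomial ι F} (hp : Irreducible p) {a : MvPolynomial ι F}
    (ha : a ≠ 0) : primeAbs p hp (algebraMap _ (RationalFunctions F ι) a) =
      Real.exp (-((p.totalDegree : ℝ) * (multiplicity p a : ℝ))) :=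
  expAbs_algebraMap ha

variable (F ι) in
/-- The absolute value `exp (deg)` attached to the hyperplane at infinity. -/
def inftyAbs : AbsoluteValue (RationalFunctions F ι) ℝ :=
  expAbs (fun a : MvPolynomial ι F ↦ (a.totalDegree : ℝ))
    (by simp)
    (fun a b ha hb ↦ by
      rw [MvPolynomial.totalDegree_mul_of_isDomain ha hb]
      push_cast
      ring)
    (fun a b _ _ _ ↦ by exact_mod_cast MvPolynomial.totalDegree_add a b)

lemma inftyAbs_algebraMap {a : MvPolynomial ι F} (ha : a ≠ 0) :
    inftyAbs F ι (algebraMap _ (RationalFunctions F ι) a) = Real.exp (a.totalDegree : ℝ) :=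
  expAbs_algebraMap ha

variable (F ι) in
/-- The set of absolute values attached to the prime divisors of projective space. -/
def divisorAbs : Set (AbsoluteValue (RationalFunctions F ι) ℝ) :=
  {v | v = inftyAbs F ι ∨ ∃ (p : MvPolynomial ι F) (hp : Irreducible p), v = primeAbs p hp}

lemma inftyAbs_mem : inftyAbs F ι ∈ divisorAbs F ι := Or.inl rfl

lemma primeAbs_mem (p : MvPolynomial ι F) (hp : Irreducible p) :
    primeAbs p hp ∈ divisorAbs F ι := Or.inr ⟨p, hp, rfl⟩

lemma totalDegree_of_isUnit {a : MvPolynomial ι F} (ha : IsUnit a) : a.totalDegree = 0 := by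
  obtain ⟨b, hb⟩ := ha.exists_right_inv
  have hb0 : b ≠ 0 := by
    rintro rfl
    simp at hb
  have := MvPolynomial.totalDegree_mul_of_isDomain ha.ne_zero hb0
  rw [hb, MvPolynomial.totalDegree_one] at this
  omega

lemma totalDegree_ne_zero {p : MvPolynomial ι F} (hp : Irreducible p) : p.totalDegree ≠ 0 := by
  intro h
  rw [MvPolynomial.totalDegree_eq_zero_iff_eq_C] at h
  refine hp.not_isUnit ?_
  rw [h]
  refine (IsUnit.mk0 _ fun h0 ↦ hp.ne_zero ?_).map MvPolynomial.C
  rw [h, h0, map_zero]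

lemma primeAbs_of_associated {p q : MvPolynomial ι F} (hp : Irreducible p) (hq : Irreducible q)
    (h : Associated p q) : primeAbs p hp = primeAbs q hq := by
  have hd : p.totalDegree = q.totalDegree := by
    obtain ⟨u, rfl⟩ := h
    rw [MvPolynomial.totalDegree_mul_of_isDomain hp.ne_zero u.ne_zero,
      totalDegree_of_isUnit u.isUnit, add_zero]
  have key : ∀ a : MvPolynomial ι F, a ≠ 0 →
      primeAbs p hp (algebraMap _ _ a) = primeAbs q hq (algebraMap _ _ a) := fun a ha ↦ by
    rw [primeAbs_algebraMap hp ha, primeAbs_algebraMap hq ha, hd,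
      multiplicity_eq_of_associated_left h]
  ext x
  obtain ⟨a, b, hb, rfl⟩ := IsFractionRing.div_surjective (A := MvPolynomial ι F) x
  rcases eq_or_ne a 0 with rfl | ha
  · simp
  · rw [map_div₀, map_div₀, key a ha, key b (nonZeroDivisors.ne_zero hb)]

/-- Finite support and the product formula for one element. -/
def ProductFormulaAt (x : RationalFunctions F ι) : Prop :=
  (fun v : divisorAbs F ι ↦ v.val x).HasFiniteMulSupport ∧ ∏ᶠ v : divisorAbs F ι, v.val x = 1

lemma ProductFormulaAt.mul {x y : RationalFunctions F ι} (hx : ProductFormulaAt x)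
    (hy : ProductFormulaAt y) : ProductFormulaAt (x * y) := by
  have h : (fun v : divisorAbs F ι ↦ v.val (x * y)) = fun v ↦ v.val x * v.val y :=
    funext fun v ↦ map_mul _ _ _
  refine ⟨?_, ?_⟩
  · rw [h]
    exact hx.1.mul hy.1
  · rw [h, finprod_mul_distrib hx.1 hy.1, hx.2, hy.2, one_mul]

lemma ProductFormulaAt.inv {x : RationalFunctions F ι} (hx : ProductFormulaAt x) :
    ProductFormulaAt x⁻¹ := by
  have h : (fun v : divisorAbs F ι ↦ v.val x⁻¹) = fun v ↦ (v.val x)⁻¹ :=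
    funext fun v ↦ map_inv₀ _ _
  refine ⟨?_, ?_⟩
  · rw [h]
    exact hx.1.inv
  · rw [h, finprod_inv_distrib, hx.2, inv_one]

lemma productFormulaAt_unit {a : MvPolynomial ι F} (ha : IsUnit a) :
    ProductFormulaAt (algebraMap _ (RationalFunctions F ι) a) := by
  have h : ∀ v : divisorAbs F ι, v.val (algebraMap _ (RationalFunctions F ι) a) = 1 := by
    rintro ⟨v, rfl | ⟨p, hp, rfl⟩⟩
    · simp [inftyAbs_algebraMap ha.ne_zero, totalDegree_of_isUnit ha]
    · have : multiplicity p a = 0 :=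
        multiplicity_eq_zero.2 fun h ↦ hp.not_isUnit (isUnit_of_dvd_unit h ha)
      simp [primeAbs_algebraMap hp ha.ne_zero, this]
  simp only [ProductFormulaAt, h]
  simp [Function.HasFiniteMulSupport]

lemma productFormulaAt_irreducible {q : MvPolynomial ι F} (hq : Irreducible q) :
    ProductFormulaAt (algebraMap _ (RationalFunctions F ι) q) := by
  classical
  let vq : divisorAbs F ι := ⟨primeAbs q hq, primeAbs_mem q hq⟩
  let vi : divisorAbs F ι := ⟨inftyAbs F ι, inftyAbs_mem⟩
  have hpos : (0 : ℝ) < q.totalDegree := by exact_mod_cast Nat.pos_of_ne_zero (totalDegree_ne_zero hq)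
  have hvq : vq.val (algebraMap _ (RationalFunctions F ι) q) = Real.exp (-(q.totalDegree : ℝ)) := by
    simp [vq, primeAbs_algebraMap hq hq.ne_zero]
  have hvi : vi.val (algebraMap _ (RationalFunctions F ι) q) = Real.exp (q.totalDegree : ℝ) :=
    inftyAbs_algebraMap hq.ne_zero
  have hne : vq ≠ vi := by
    intro h
    rw [h, hvi, Real.exp_eq_exp] at hvq
    linarith
  have hsub : (Function.mulSupport fun v : divisorAbs F ι ↦
      v.val (algebraMap _ (RationalFunctions F ι) q)) ⊆ (({vq, vi} : Finset (divisorAbs F ι)) :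
        Set (divisorAbs F ι)) := by
    rintro ⟨v, rfl | ⟨p, hp, rfl⟩⟩ hv
    · simp [vi]
    · by_cases hpq : p ∣ q
      · have := primeAbs_of_associated hp hq (hp.associated_of_dvd hq hpq)
        simp [vq, this]
      · refine absurd ?_ hv
        simp [primeAbs_algebraMap hp hq.ne_zero, multiplicity_eq_zero.2 hpq]
  refine ⟨(Finset.finite_toSet _).subset hsub, ?_⟩
  rw [finprod_eq_prod_of_mulSupport_subset _ hsub, Finset.prod_pair hne, hvq, hvi, ← Real.exp_add]
  simp

lemma productFormulaAt_polynomial {a : MvPolynomial ι F} (ha : a ≠ 0) :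
    ProductFormulaAt (algebraMap _ (RationalFunctions F ι) a) := by
  induction a using UniqueFactorizationMonoid.induction_on_prime with
  | h₁ => exact absurd rfl ha
  | h₂ a h => exact productFormulaAt_unit h
  | h₃ a p ha' hp ih =>
    rw [map_mul]
    exact (productFormulaAt_irreducible hp.irreducible).mul (ih ha')

lemma productFormulaAt {x : RationalFunctions F ι} (hx : x ≠ 0) : ProductFormulaAt x := by
  obtain ⟨a, b, hb, rfl⟩ := IsFractionRing.div_surjective (A := MvPolynomial ι F) x
  have ha : a ≠ 0 := by
    rintro rfl
    simp at hx
  rw [div_eq_mul_inv]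
  exact (productFormulaAt_polynomial ha).mul
    (productFormulaAt_polynomial (nonZeroDivisors.ne_zero hb)).inv

/-- The field of rational functions in the variables `t_i` over `F`, with the absolute values
attached to the prime divisors of projective space. -/
instance rationalFunctionsAbsValues : Height.AdmissibleAbsValues (RationalFunctions F ι) where
  archAbsVal := 0
  nonarchAbsVal := divisorAbs F ι
  isNonarchimedean := by
    rintro v (rfl | ⟨p, hp, rfl⟩)
    · exact expAbs_isNonarchimedean _ _ _ _
    · exact expAbs_isNonarchimedean _ _ _ _
  hasFiniteMulSupport hx := (productFormulaAt hx).1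
  product_formula hx := by
    rw [Multiset.map_zero, Multiset.prod_zero, one_mul]
    exact (productFormulaAt hx).2

end FunctionField

section Generic

variable (F : Type u) [Field F] (m : ℕ)

/-- The generic parameter `t = (t_1, …, t_m)`, a point over `F(t_1, …, t_m)`. -/
def genericParameter : Fin m → RationalFunctions F (Fin m) :=
  fun j ↦ algebraMap (MvPolynomial (Fin m) F) (RationalFunctions F (Fin m)) (MvPolynomial.X j)

variable {F m}

/-- A point of `𝔸^m(F)`, viewed over `F(t_1, …, t_m)`. -/
def constantPoint (c : Fin m → F) : Fin m → RationalFunctions F (Fin m) :=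
  fun j ↦ algebraMap (MvPolynomial (Fin m) F) (RationalFunctions F (Fin m)) (MvPolynomial.C (c j))

end Generic

end SpecializationHeight

end

/-! The canonical height is a sum of averaged local escape rates, the limits of `orbitHeight w d t c
n / d ^ n`, where `w` runs over the conjugates of the extended places. It suffices to compare each
rate with `log (affineMax w t) / d`, with an error independent of `d` and `t` that vanishes at
almost all places.

Write |x| for `affineMax w x`. The vector of differences f(c_i) - c_i^d is a Vandermonde matrix
applied to t, invertible because the c_i are distinct (`parameter_eq`). Hence, once |t| dominates
B^d, where B bounds the c_i, a single step carries c to a point of size about |t|, with constants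
free of d. Since m ≥ 2, that point lies in the region |x|^2 ≥ 2m|t|, which is forward invariant and
on which |f(x)| and |x|^d differ by a factor of at most 2; telescoping then costs only log 2. If
instead |t| is at most a constant times B^d, both quantities are bounded separately. This is
`abs_sub_le_localBound`.

At nonarchimedean places where c and the inverse Vandermonde matrix are integral there is no error
(`orbitHeight_succ_of_isNonarchimedean`). Over the function field every place is of this kind, so
the generic canonical height is exactly 1/d (`tendsto_generic`). Averaging over embeddings and
summing over places gives `exists_tendsto_weilHeight`. -/

namespace SpecializationHeight

/-! ### Sequences that nearly scale by a factor D -/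

section Sequences

/-- Tate's telescoping argument: the normalized terms move by at most E / D^(n+1), and the geometric
series sums to E / (D - 1) ≤ E. -/
lemma exists_tendsto_div_pow {u : ℕ → ℝ} {D E : ℝ} (hD : 2 ≤ D)
    (h : ∀ n, |u (n + 1) - D * u n| ≤ E) :
    ∃ l, Tendsto (fun n ↦ u n / D ^ n) atTop (𝓝 l) ∧ |l - u 0| ≤ E := by
  have hD0 : (0 : ℝ) < D := by linarith
  have hE : 0 ≤ E := (abs_nonneg _).trans (h 0)
  have hr : D⁻¹ < 1 := inv_lt_one_of_one_lt₀ (by linarith)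
  have hdist : ∀ n, dist (u n / D ^ n) (u (n + 1) / D ^ (n + 1)) ≤ E / D * D⁻¹ ^ n := fun n ↦ by
    have : u (n + 1) / D ^ (n + 1) - u n / D ^ n = (u (n + 1) - D * u n) / D ^ (n + 1) := by
      field_simp
      ring
    rw [dist_comm, Real.dist_eq, this, abs_div, abs_of_pos (pow_pos hD0 _), inv_pow, ← div_eq_mul_inv,
      div_div, pow_succ' D]
    exact div_le_div_of_nonneg_right (h n) (by positivity)
  obtain ⟨l, hl⟩ := cauchySeq_tendsto_of_complete (cauchySeq_of_le_geometric _ _ hr hdist)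
  refine ⟨l, hl, ?_⟩
  have := dist_le_of_le_geometric_of_tendsto₀ _ _ hr hdist hl
  rw [dist_comm, Real.dist_eq] at this
  simp only [pow_zero, div_one] at this
  refine this.trans ?_
  have h2 : E / D / (1 - D⁻¹) = E / (D - 1) := by field_simp
  rw [h2, div_le_iff₀ (by linarith)]
  nlinarith

/-- One-sided telescoping that keeps the denominator D - 1. This matters when E contains log |t|,
which may grow linearly in D. -/
lemma le_of_tendsto_div_pow {u : ℕ → ℝ} {D E l : ℝ} (hD : 2 ≤ D) (hE : 0 ≤ E)
    (h : ∀ n, u (n + 1) ≤ D * u n + E) (hl : Tendsto (fun n ↦ u n / D ^ n) atTop (𝓝 l)) :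
    l ≤ u 0 + E / (D - 1) := by
  have hD0 : (0 : ℝ) < D := by linarith
  have hD1 : (0 : ℝ) < D - 1 := by linarith
  have key : ∀ n, u n + E / (D - 1) ≤ D ^ n * (u 0 + E / (D - 1)) := fun n ↦ by
    induction n with
    | zero => simp
    | succ n ih =>
      have e : D * (u n + E / (D - 1)) = D * u n + E + E / (D - 1) := by
        field_simp
        ring
      calc u (n + 1) + E / (D - 1) ≤ D * (u n + E / (D - 1)) := by
            rw [e]
            linarith [h n]
        _ ≤ D * (D ^ n * (u 0 + E / (D - 1))) := by gcongr
        _ = _ := by ring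
  refine le_of_tendsto' hl fun n ↦ ?_
  rw [div_le_iff₀ (pow_pos hD0 n)]
  have : 0 ≤ E / (D - 1) := by positivity
  linarith [key n]

end Sequences

/-! ### Local sizes and the Vandermonde relation -/

section Local

variable {k : Type*} [Field k] {m : ℕ}

/-- The maximum of `1` and the absolute values of the entries of `x`. -/
noncomputable def affineMax (w : AbsoluteValue k ℝ) (x : Fin m → k) : ℝ :=
  ⨆ i, w ((Fin.cons 1 x : Fin (m + 1) → k) i)

variable (w : AbsoluteValue k ℝ) (x : Fin m → k)

lemma affineMax_le_iff {b : ℝ} : affineMax w x ≤ b ↔ 1 ≤ b ∧ ∀ i, w (x i) ≤ b := by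
  rw [affineMax, ciSup_le_iff (Set.finite_range _).bddAbove, Fin.forall_fin_succ]
  simp

lemma one_le_affineMax : 1 ≤ affineMax w x := ((affineMax_le_iff w x).1 le_rfl).1

lemma affineMax_pos : 0 < affineMax w x := one_pos.trans_le (one_le_affineMax w x)

lemma le_affineMax (i : Fin m) : w (x i) ≤ affineMax w x := ((affineMax_le_iff w x).1 le_rfl).2 i

lemma exists_eq_affineMax (h : 1 < affineMax w x) : ∃ i, w (x i) = affineMax w x := by
  by_contra! hne
  obtain ⟨i, hi⟩ := exists_eq_ciSup_of_finite (f := fun i ↦ w ((Fin.cons 1 x : Fin (m + 1) → k) i))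
  change _ = affineMax w x at hi
  induction i using Fin.cases with
  | zero => simp at hi; linarith
  | succ i => exact hne i (by simpa using hi)

/-- The map `f × ⋯ × f` on `𝔸^m`, with `f = family d t`. -/
noncomputable def familyEval (d : ℕ) (t x : Fin m → k) : Fin m → k :=
  fun i ↦ (family d t).eval (x i)

lemma familyEval_apply (d : ℕ) (t x : Fin m → k) (i : Fin m) :
    familyEval d t x i = x i ^ d + ∑ j : Fin m, t j * x i ^ (m - 1 - (j : ℕ)) := by
  simp [familyEval, family, Polynomial.eval_finsetSum]

/-- The Vandermonde matrix with decreasing powers. -/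
def revVandermonde (c : Fin m → k) : Matrix (Fin m) (Fin m) k :=
  Matrix.of fun i j ↦ c i ^ (m - 1 - (j : ℕ))

/-- Reversing the columns of an invertible Vandermonde matrix reverses the rows of its inverse. -/
lemma exists_mul_revVandermonde {c : Fin m → k} (hc : Function.Injective c) :
    ∃ G, G * revVandermonde c = 1 := by
  have hdet : IsUnit (Matrix.vandermonde c).det :=
    isUnit_iff_ne_zero.2 (Matrix.det_vandermonde_ne_zero_iff.2 hc)
  have e : revVandermonde c = (Matrix.vandermonde c).submatrix id Fin.revPerm := by
    ext i j
    simp only [revVandermonde, Matrix.of_apply, Matrix.submatrix_apply, id,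
      Matrix.vandermonde_apply, Fin.revPerm_apply, Fin.val_rev]
    congr 1
    omega
  refine ⟨(Matrix.vandermonde c)⁻¹.submatrix Fin.revPerm id, ?_⟩
  rw [e, ← Matrix.submatrix_mul _ _ _ _ _ Function.bijective_id, Matrix.nonsing_inv_mul _ hdet,
    Matrix.submatrix_one_equiv]

/-- The parameter is a linear function of the differences `f(c_i) - c_i^d`. -/
lemma parameter_eq {c : Fin m → k} {G : Matrix (Fin m) (Fin m) k}
    (hG : G * revVandermonde c = 1) (d : ℕ) (t : Fin m → k) (j : Fin m) :
    t j = ∑ i, G j i * (familyEval d t c i - c i ^ d) := by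
  have h := congrFun (congrArg (fun M ↦ M.mulVec t) hG) j
  simp only [Matrix.one_mulVec, ← Matrix.mulVec_mulVec] at h
  rw [← h, Matrix.mulVec, dotProduct]
  refine Finset.sum_congr rfl fun i _ ↦ ?_
  rw [familyEval_apply, add_sub_cancel_left, Matrix.mulVec, dotProduct]
  congr 1
  exact Finset.sum_congr rfl fun l _ ↦ by rw [revVandermonde, Matrix.of_apply, mul_comm]

variable {w x} {d : ℕ} {t : Fin m → k}

lemma abv_lowerTerm_le (y : k) {b : ℝ} (hb : 1 ≤ b) (hy : w y ≤ b) :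
    ∀ j : Fin m, w (t j * y ^ (m - 1 - (j : ℕ))) ≤ affineMax w t * b ^ (m - 1) := fun j ↦ by
  rw [map_mul, map_pow]
  gcongr
  · exact (affineMax_pos w t).le
  · exact le_affineMax w t j
  · calc w y ^ (m - 1 - (j : ℕ)) ≤ b ^ (m - 1 - (j : ℕ)) := by gcongr
      _ ≤ b ^ (m - 1) := pow_le_pow_right₀ hb (by omega)

/-- The lower terms have degree at most m - 1, whatever d is; this is what keeps the constants free
of d. -/
lemma abv_lowerSum_le (y : k) {b : ℝ} (hb : 1 ≤ b) (hy : w y ≤ b) :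
    w (∑ j : Fin m, t j * y ^ (m - 1 - (j : ℕ))) ≤ m * (affineMax w t * b ^ (m - 1)) := by
  refine (w.sum_le _ _).trans ((Finset.sum_le_sum fun j _ ↦ abv_lowerTerm_le y hb hy j).trans ?_)
  simp

lemma abv_lowerSum_le_of_isNonarchimedean (hw : IsNonarchimedean w) (hm : 0 < m) (y : k) {b : ℝ}
    (hb : 1 ≤ b) (hy : w y ≤ b) :
    w (∑ j : Fin m, t j * y ^ (m - 1 - (j : ℕ))) ≤ affineMax w t * b ^ (m - 1) := by
  have : Nonempty (Fin m) := ⟨⟨0, hm⟩⟩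
  obtain ⟨j, -, hj⟩ := hw.finset_image_add_of_nonempty (fun j : Fin m ↦ t j * y ^ (m - 1 - (j : ℕ)))
    Finset.univ_nonempty
  exact hj.trans (abv_lowerTerm_le y hb hy j)

end Local

/-! ### The escape region, for arbitrary absolute values -/

section Escape

variable {k : Type*} [Field k] {m : ℕ} {w : AbsoluteValue k ℝ} {d : ℕ} (t x : Fin m → k)

variable (w) in
lemma affineMax_familyEval_le (hd : m < d) :
    affineMax w (familyEval d t x) ≤ (m + 1) * affineMax w t * affineMax w x ^ d := by
  have hL := one_le_affineMax w t
  have hM := one_le_affineMax w x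
  have hMd : 1 ≤ affineMax w x ^ d := one_le_pow₀ hM
  have hLM : 1 ≤ affineMax w t * affineMax w x ^ d := one_le_mul_of_one_le_of_one_le hL hMd
  refine (affineMax_le_iff _ _).2 ⟨?_, fun i ↦ ?_⟩
  · rw [mul_assoc]
    exact one_le_mul_of_one_le_of_one_le (by linarith [(Nat.cast_nonneg m : (0 : ℝ) ≤ m)]) hLM
  · rw [familyEval_apply]
    calc _ ≤ w (x i ^ d) + _ := w.add_le _ _
      _ ≤ affineMax w x ^ d + m * (affineMax w t * affineMax w x ^ (m - 1)) := by
        gcongr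
        · rw [map_pow]
          gcongr
          exact le_affineMax w x i
        · exact abv_lowerSum_le _ hM (le_affineMax w x i)
      _ ≤ affineMax w t * affineMax w x ^ d + m * (affineMax w t * affineMax w x ^ d) := by
        gcongr
        · exact le_mul_of_one_le_left (by positivity) hL
        all_goals first | assumption | omega
      _ = _ := by ring

variable {x} in
/-- Far from the filled Julia set, `f` behaves like the `d`-th power map. -/
lemma pow_le_two_mul_affineMax_familyEval (hd : m < d) (hm : 2 ≤ m)
    (hx : 2 * m * affineMax w t ≤ affineMax w x ^ 2) :
    affineMax w x ^ d ≤ 2 * affineMax w (familyEval d t x) := by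
  have hL := one_le_affineMax w t
  have hM := one_le_affineMax w x
  have hm' : (2 : ℝ) ≤ m := by exact_mod_cast hm
  have h1 : 1 < affineMax w x := by nlinarith
  obtain ⟨i, hi⟩ := exists_eq_affineMax w x h1
  have hs := abv_lowerSum_le (w := w) (t := t) (x i) hM hi.le
  -- In the escape region the lower terms amount to at most half of |x|^d: two powers of |x| absorb
  -- the factor 2m|t|, and m + 1 ≤ d.
  have hle : 2 * (m * (affineMax w t * affineMax w x ^ (m - 1))) ≤ affineMax w x ^ d := by
    calc _ = (2 * m * affineMax w t) * affineMax w x ^ (m - 1) := by ring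
      _ ≤ affineMax w x ^ 2 * affineMax w x ^ (m - 1) := by gcongr
      _ = affineMax w x ^ (m + 1) := by rw [← pow_add]; congr 1; omega
      _ ≤ _ := pow_le_pow_right₀ hM hd
  have hf := le_affineMax w (familyEval d t x) i
  -- Reverse triangle inequality at a coordinate realizing the maximum.
  have htri := w.add_le (familyEval d t x i) (-∑ j : Fin m, t j * x i ^ (m - 1 - (j : ℕ)))
  rw [familyEval_apply, add_neg_cancel_right, map_pow, hi, w.map_neg, ← familyEval_apply] at htri
  linarith

variable {x} in
lemma affineMax_familyEval_le_two_mul (hd : m < d) (hm : 2 ≤ m)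
    (hx : 2 * m * affineMax w t ≤ affineMax w x ^ 2) :
    affineMax w (familyEval d t x) ≤ 2 * affineMax w x ^ d := by
  have hL := one_le_affineMax w t
  have hM := one_le_affineMax w x
  have hm' : (2 : ℝ) ≤ m := by exact_mod_cast hm
  have hle : 2 * (m * (affineMax w t * affineMax w x ^ (m - 1))) ≤ affineMax w x ^ d := by
    calc _ = (2 * m * affineMax w t) * affineMax w x ^ (m - 1) := by ring
      _ ≤ affineMax w x ^ 2 * affineMax w x ^ (m - 1) := by gcongr
      _ = affineMax w x ^ (m + 1) := by rw [← pow_add]; congr 1; omega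
      _ ≤ _ := pow_le_pow_right₀ hM hd
  have hMd : 1 ≤ affineMax w x ^ d := one_le_pow₀ hM
  refine (affineMax_le_iff _ _).2 ⟨by linarith, fun i ↦ ?_⟩
  rw [familyEval_apply]
  have h1 := w.add_le (x i ^ d) (∑ j : Fin m, t j * x i ^ (m - 1 - (j : ℕ)))
  have h2 := abv_lowerSum_le (w := w) (t := t) (x i) hM (le_affineMax w x i)
  have h3 : w (x i ^ d) ≤ affineMax w x ^ d := by
    rw [map_pow]
    gcongr
    exact le_affineMax w x i
  linarith

variable {x} in
-- Forward invariance of the escape region: there |x|^2 ≥ 4 and d ≥ 3, so |x|^d / 2 is at least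
-- 2|x|.
lemma le_affineMax_familyEval (hd : m < d) (hm : 2 ≤ m)
    (hx : 2 * m * affineMax w t ≤ affineMax w x ^ 2) :
    affineMax w x ≤ affineMax w (familyEval d t x) := by
  have hL := one_le_affineMax w t
  have hM := one_le_affineMax w x
  have hm' : (2 : ℝ) ≤ m := by exact_mod_cast hm
  have h2 := pow_le_two_mul_affineMax_familyEval t hd hm hx
  have h3 : affineMax w x ^ 3 ≤ affineMax w x ^ d := pow_le_pow_right₀ hM (by omega)
  have h4 : 4 ≤ affineMax w x ^ 2 := by nlinarith
  have h5 : affineMax w x ^ 3 = affineMax w x * affineMax w x ^ 2 := by ring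
  nlinarith

variable (w) in
/-- The logarithmic height contribution of the iterates satisfies `u_{n+1} = d u_n + O(1)`. -/
lemma abs_log_affineMax_familyEval_sub_le (hd : m < d) (hm : 2 ≤ m) :
    |Real.log (affineMax w (familyEval d t x)) - d * Real.log (affineMax w x)| ≤
      d * Real.log (2 * m * affineMax w t) + Real.log ((m + 1) * affineMax w t) + Real.log 2 := by
  have hL := one_le_affineMax w t
  have hM := one_le_affineMax w x
  have hF := one_le_affineMax w (familyEval d t x)
  have hm' : (2 : ℝ) ≤ m := by exact_mod_cast hm
  have l1 : 0 ≤ Real.log (2 * m * affineMax w t) := Real.log_nonneg (by nlinarith)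
  have l2 : 0 ≤ Real.log ((m + 1) * affineMax w t) := Real.log_nonneg (by nlinarith)
  have l3 : 0 ≤ Real.log 2 := Real.log_nonneg (by norm_num)
  have l4 : 0 ≤ d * Real.log (2 * m * affineMax w t) := by positivity
  have l5 : 0 ≤ Real.log (affineMax w (familyEval d t x)) := Real.log_nonneg hF
  have l6 : 0 ≤ Real.log (affineMax w x) := Real.log_nonneg hM
  rw [abs_le]
  constructor
  -- Outside the escape region `d * log |x|` is itself at most the first error term, so no lower
  -- bound for the image is needed.
  · rcases le_total (2 * m * affineMax w t) (affineMax w x ^ 2) with h | h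
    · have := Real.log_le_log (by positivity) (pow_le_two_mul_affineMax_familyEval t hd hm h)
      rw [Real.log_pow, Real.log_mul (by norm_num) (by positivity)] at this
      linarith
    · have := Real.log_le_log (by positivity) h
      rw [Real.log_pow] at this
      push_cast at this
      have : (d : ℝ) * Real.log (affineMax w x) ≤ d * Real.log (2 * m * affineMax w t) := by
        gcongr
        nlinarith
      linarith
  · have := Real.log_le_log (by positivity) (affineMax_familyEval_le w t x hd)
    rw [Real.log_mul (by positivity) (by positivity), Real.log_pow] at this
    linarith

end Escape

/-! ### Local comparison, uniform in the degree and the parameter -/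

section LocalEstimate

variable {k : Type*} [Field k] {m : ℕ} {w : AbsoluteValue k ℝ} {d : ℕ}

/-- The local contribution to the height of the `n`-th iterate of `c`. -/
noncomputable def orbitHeight (w : AbsoluteValue k ℝ) (d : ℕ) (t c : Fin m → k) (n : ℕ) : ℝ :=
  Real.log (affineMax w ((familyEval d t)^[n] c))

lemma orbitHeight_zero (t c : Fin m → k) : orbitHeight w d t c 0 = Real.log (affineMax w c) := rfl

lemma orbitHeight_nonneg (t c : Fin m → k) (n : ℕ) : 0 ≤ orbitHeight w d t c n :=
  Real.log_nonneg (one_le_affineMax _ _)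

variable (w) in
-- Only existence matters here, so an error depending on `d` and `t` is harmless.
lemma exists_tendsto_orbitHeight (hd : m < d) (hm : 2 ≤ m) (t c : Fin m → k) :
    ∃ l, Tendsto (fun n ↦ orbitHeight w d t c n / (d : ℝ) ^ n) atTop (𝓝 l) := by
  have hd' : (2 : ℝ) ≤ d := by exact_mod_cast hm.trans hd.le
  obtain ⟨l, hl, -⟩ := exists_tendsto_div_pow hd' (u := orbitHeight w d t c) fun n ↦ by
    rw [orbitHeight, orbitHeight, Function.iterate_succ_apply']
    exact abs_log_affineMax_familyEval_sub_le w t _ hd hm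
  exact ⟨l, hl⟩

/-- An explicit bound for the local error terms, independent of the degree. -/
noncomputable def localBound (m : ℕ) (A B : ℝ) : ℝ :=
  Real.log 2 + Real.log (m + 1) + (m + 3) * Real.log B + Real.log (2 * m * A) +
    Real.log (8 * m ^ 3 * A ^ 2)

variable {A B : ℝ} {c : Fin m → k} {G : Matrix (Fin m) (Fin m) k}

/-- Inverts the Vandermonde relation: the first iterate controls the parameter, and the degree
enters only through B^d. -/
lemma affineMax_parameter_le (hA : 1 ≤ A) (hB : 1 ≤ B) (hm : 2 ≤ m)
    (hG : G * revVandermonde c = 1) (hGA : ∀ i j, w (G i j) ≤ A) (hcB : ∀ i, w (c i) ≤ B)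
    (t : Fin m → k) :
    affineMax w t ≤ m * A * (affineMax w (familyEval d t c) + B ^ d) := by
  have hF := one_le_affineMax w (familyEval d t c)
  have hm' : (2 : ℝ) ≤ m := by exact_mod_cast hm
  have hBd : 0 ≤ B ^ d := by positivity
  have hmA : 1 ≤ m * A := by nlinarith
  refine (affineMax_le_iff _ _).2 ⟨by nlinarith, fun j ↦ ?_⟩
  rw [parameter_eq hG d t j]
  refine (w.sum_le _ _).trans ?_
  have : ∀ i ∈ Finset.univ, w (G j i * (familyEval d t c i - c i ^ d)) ≤
      A * (affineMax w (familyEval d t c) + B ^ d) := fun i _ ↦ by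
    rw [map_mul]
    have h1 := w.add_le (familyEval d t c i) (-c i ^ d)
    rw [← sub_eq_add_neg, w.map_neg, map_pow] at h1
    have h2 : w (c i) ^ d ≤ B ^ d := by
      gcongr
      exact hcB i
    have h3 := le_affineMax w (familyEval d t c) i
    have h4 := hGA j i
    gcongr
    linarith
  refine (Finset.sum_le_sum this).trans_eq ?_
  simp [mul_assoc]

/-- When the parameter dominates B^d it absorbs the leading terms c_i^d, so the constant does not
involve d. -/
lemma affineMax_familyEval_le_mul (hB : 1 ≤ B) (hcB : ∀ i, w (c i) ≤ B) (t : Fin m → k)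
    (h : B ^ d ≤ affineMax w t) :
    affineMax w (familyEval d t c) ≤ (m + 1) * B ^ m * affineMax w t := by
  have hL := one_le_affineMax w t
  have hBm : 1 ≤ B ^ m := one_le_pow₀ hB
  have hm' : (0 : ℝ) ≤ m := Nat.cast_nonneg m
  have hLB : 1 ≤ B ^ m * affineMax w t := one_le_mul_of_one_le_of_one_le hBm hL
  refine (affineMax_le_iff _ _).2 ⟨by nlinarith, fun i ↦ ?_⟩
  rw [familyEval_apply]
  have h1 := w.add_le (c i ^ d) (∑ j : Fin m, t j * c i ^ (m - 1 - (j : ℕ)))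
  have h2 := abv_lowerSum_le (w := w) (t := t) (c i) hB (hcB i)
  have h3 : w (c i ^ d) ≤ B ^ d := by
    rw [map_pow]
    gcongr
    exact hcB i
  have h4 : m * (affineMax w t * B ^ (m - 1)) ≤ m * (affineMax w t * B ^ m) := by
    gcongr
    all_goals first | assumption | omega
  nlinarith

/-- The local comparison between the canonical height and the height of the parameter. -/
theorem abs_sub_le_localBound (hA : 1 ≤ A) (hB : 1 ≤ B) (hd : m < d) (hm : 2 ≤ m)
    (hG : G * revVandermonde c = 1) (hGA : ∀ i j, w (G i j) ≤ A) (hcB : ∀ i, w (c i) ≤ B)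
    (t : Fin m → k) {l : ℝ}
    (hl : Tendsto (fun n ↦ orbitHeight w d t c n / (d : ℝ) ^ n) atTop (𝓝 l)) :
    |l - Real.log (affineMax w t) / d| ≤ localBound m A B := by
  have hL := one_le_affineMax w t
  have hm' : (2 : ℝ) ≤ m := by exact_mod_cast hm
  have hd' : (3 : ℝ) ≤ d := by exact_mod_cast (show 3 ≤ d by omega)
  have hBd : 1 ≤ B ^ d := one_le_pow₀ hB
  have hmA : 1 ≤ m * A := by nlinarith
  have hmA2 : 1 ≤ 2 * m * A := by nlinarith
  have hD : 2 * (m * A) ≤ 8 * m ^ 3 * A ^ 2 := by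
    nlinarith [mul_le_mul hmA hm' (by norm_num) (by positivity), mul_pos (show (0 : ℝ) < m by linarith) (show (0 : ℝ) < A by linarith)]
  have hD1 : 1 ≤ 8 * m ^ 3 * A ^ 2 := by linarith
  have l1 : 0 ≤ Real.log 2 := Real.log_nonneg (by norm_num)
  have l2 : 0 ≤ Real.log (m + 1) := Real.log_nonneg (by linarith)
  have l3 : 0 ≤ Real.log B := Real.log_nonneg hB
  have l4 : 0 ≤ Real.log (2 * m * A) := Real.log_nonneg hmA2
  have l5 : 0 ≤ Real.log (8 * m ^ 3 * A ^ 2) := Real.log_nonneg hD1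
  have l6 : 0 ≤ Real.log (affineMax w t) := Real.log_nonneg hL
  have l7 : 0 ≤ m * Real.log B := by positivity
  have hl0 : 0 ≤ l := ge_of_tendsto' hl fun n ↦ div_nonneg (orbitHeight_nonneg t c n) (by positivity)
  rw [localBound]
  -- The threshold is (2mA)^2 · 2m · B^d: it gives |t| ≤ 2mA|f(c)|, and then |f(c)|^2 ≥ 2m|t|, which
  -- places the first iterate in the escape region.
  rcases le_total (8 * m ^ 3 * A ^ 2 * B ^ d) (affineMax w t) with h | h
  · have hLB : B ^ d ≤ affineMax w t := (le_mul_of_one_le_left (by positivity) hD1).trans h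
    have hup := affineMax_familyEval_le_mul hB hcB t hLB
    have hlow : affineMax w t ≤ 2 * m * A * affineMax w (familyEval d t c) := by
      have h1 := affineMax_parameter_le (d := d) hA hB hm hG hGA hcB t
      have h2 : 2 * (m * A) * B ^ d ≤ affineMax w t :=
        (mul_le_mul_of_nonneg_right hD (by positivity)).trans h
      linarith
    have hesc : 2 * m * affineMax w t ≤ affineMax w (familyEval d t c) ^ 2 := by
      have h1 : 8 * m ^ 3 * A ^ 2 ≤ affineMax w t :=
        (le_mul_of_one_le_right (by linarith) hBd).trans h
      have h2 : affineMax w t ^ 2 ≤ (2 * m * A) ^ 2 * affineMax w (familyEval d t c) ^ 2 := by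
        rw [← mul_pow]
        gcongr
      have h3 : 8 * m ^ 3 * A ^ 2 * affineMax w t ≤ affineMax w t ^ 2 := by
        rw [sq (affineMax w t)]
        exact mul_le_mul_of_nonneg_right h1 (affineMax_pos w t).le
      have h4 : 0 < (2 * m * A) ^ 2 := by positivity
      refine le_of_mul_le_mul_left ?_ h4
      calc _ = 8 * m ^ 3 * A ^ 2 * affineMax w t := by ring
        _ ≤ _ := h3.trans h2
    have hesc' : ∀ n, 2 * m * affineMax w t ≤
        affineMax w ((familyEval d t)^[n] (familyEval d t c)) ^ 2 := fun n ↦ by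
      induction n with
      | zero => exact hesc
      | succ n ih =>
        rw [Function.iterate_succ_apply']
        have := affineMax_pos w ((familyEval d t)^[n] (familyEval d t c))
        exact ih.trans (by gcongr; exact le_affineMax_familyEval t hd hm ih)
    -- Telescoping starts at the first iterate, since c itself need not lie in the escape region;
    -- the resulting limit is `d * l`.
    obtain ⟨l', hl', hl'2⟩ := exists_tendsto_div_pow (D := d) (E := Real.log 2)
      (u := fun n ↦ orbitHeight w d t c (n + 1)) (by linarith) fun n ↦ by
        simp only [orbitHeight]
        rw [Function.iterate_succ_apply' _ (n + 1), Function.iterate_succ_apply]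
        have h1 := Real.log_le_log (pow_pos (affineMax_pos w _) _)
          (pow_le_two_mul_affineMax_familyEval t hd hm (hesc' n))
        have h2 := Real.log_le_log (affineMax_pos w _)
          (affineMax_familyEval_le_two_mul t hd hm (hesc' n))
        rw [Real.log_pow, Real.log_mul (by norm_num) (affineMax_pos w _).ne'] at h1
        rw [Real.log_mul (by norm_num) (pow_pos (affineMax_pos w _) _).ne', Real.log_pow] at h2
        rw [abs_le]
        constructor <;> linarith
    have hll : l' / d = l := by
      refine tendsto_nhds_unique ?_ (hl.comp (tendsto_add_atTop_nat 1))
      refine (hl'.div_const _).congr fun n ↦ ?_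
      rw [Function.comp_apply, pow_succ, div_div]
    have hu1 : orbitHeight w d t c (0 + 1) = Real.log (affineMax w (familyEval d t c)) := rfl
    rw [hu1] at hl'2
    have g1 := Real.log_le_log (affineMax_pos w _) hup
    have g2 := Real.log_le_log (affineMax_pos w _) hlow
    have hBm : (0 : ℝ) < B ^ m := by positivity
    rw [Real.log_mul (by positivity) (affineMax_pos w _).ne', Real.log_mul (by positivity) hBm.ne',
      Real.log_pow] at g1
    rw [Real.log_mul (by positivity) (affineMax_pos w _).ne'] at g2
    rw [← hll, ← sub_div, abs_div, abs_of_pos (show (0 : ℝ) < d by linarith)]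
    refine (div_le_self (abs_nonneg _) (by linarith)).trans ?_
    rw [abs_le] at hl'2 ⊢
    constructor <;> linarith [hl'2.1, hl'2.2]
  -- For a small parameter both `l` and `log |t| / d` are nonnegative and bounded. The `d * log B`
  -- in log |t| is neutralized by division by d or d - 1.
  · have hlogL : Real.log (affineMax w t) ≤ Real.log (8 * m ^ 3 * A ^ 2) + d * Real.log B := by
      have := Real.log_le_log (affineMax_pos w _) h
      rwa [Real.log_mul (by linarith) (by linarith), Real.log_pow] at this
    have hlogc : orbitHeight w d t c 0 ≤ Real.log B :=
      Real.log_le_log (affineMax_pos w _) ((affineMax_le_iff _ _).2 ⟨hB, hcB⟩)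
    have hE : 0 ≤ Real.log (m + 1) + Real.log (affineMax w t) := by linarith
    have hup := le_of_tendsto_div_pow (u := orbitHeight w d t c) (by linarith) hE (fun n ↦ by
      rw [orbitHeight, orbitHeight, Function.iterate_succ_apply']
      have := Real.log_le_log (affineMax_pos w _)
        (affineMax_familyEval_le w t ((familyEval d t)^[n] c) hd)
      have hp := affineMax_pos w t
      have hq := affineMax_pos w ((familyEval d t)^[n] c)
      rw [Real.log_mul (by positivity) (by positivity), Real.log_pow,
        Real.log_mul (by positivity) (by positivity)] at this
      linarith) hl
    have hfrac : (Real.log (m + 1) + Real.log (affineMax w t)) / ((d : ℝ) - 1) ≤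
        Real.log (m + 1) + Real.log (8 * m ^ 3 * A ^ 2) + 2 * Real.log B := by
      rw [div_le_iff₀ (by linarith)]
      nlinarith
    have hfrac' : Real.log (affineMax w t) / d ≤ Real.log (8 * m ^ 3 * A ^ 2) + Real.log B := by
      rw [div_le_iff₀ (by linarith)]
      nlinarith
    have hfrac0 : 0 ≤ Real.log (affineMax w t) / d := by positivity
    rw [abs_le]
    constructor <;> linarith

end LocalEstimate

/-! ### Exact formulas at places of good reduction -/

section GoodPlaces

variable {k : Type*} [Field k] {m : ℕ} {w : AbsoluteValue k ℝ} {d : ℕ}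
  {c : Fin m → k} {G : Matrix (Fin m) (Fin m) k}

/-- With |t| ≤ |x| every lower term is at most |x|^m, which is strictly below |x|^d unless |x| = 1;
the ultrametric inequality then leaves no error. -/
lemma affineMax_familyEval_of_isNonarchimedean (hw : IsNonarchimedean w) (hd : m < d) (hm : 2 ≤ m)
    {t x : Fin m → k} (h : affineMax w t ≤ affineMax w x) :
    affineMax w (familyEval d t x) = affineMax w x ^ d := by
  have hL := one_le_affineMax w t
  have hM := one_le_affineMax w x
  have hlow : ∀ i, w (∑ j : Fin m, t j * x i ^ (m - 1 - (j : ℕ))) ≤ affineMax w x ^ m := fun i ↦ by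
    refine (abv_lowerSum_le_of_isNonarchimedean hw (by omega) (x i) hM (le_affineMax w x i)).trans ?_
    calc _ ≤ affineMax w x * affineMax w x ^ (m - 1) := by gcongr
      _ = _ := by rw [← pow_succ']; congr 1; omega
  have hpow : ∀ i, w (x i ^ d) ≤ affineMax w x ^ d := fun i ↦ by
    rw [map_pow]
    gcongr
    exact le_affineMax w x i
  refine le_antisymm ((affineMax_le_iff _ _).2 ⟨one_le_pow₀ hM, fun i ↦ ?_⟩) ?_
  · rw [familyEval_apply]
    exact (hw _ _).trans (max_le (hpow i) ((hlow i).trans (pow_le_pow_right₀ hM hd.le)))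
  · rcases hM.eq_or_lt with h1 | h1
    · rw [← h1, one_pow]
      exact one_le_affineMax _ _
    · obtain ⟨i, hi⟩ := exists_eq_affineMax w x h1
      refine le_trans ?_ (le_affineMax w _ i)
      have hlt : w (∑ j : Fin m, t j * x i ^ (m - 1 - (j : ℕ))) < w (x i ^ d) := by
        rw [map_pow, hi]
        exact (hlow i).trans_lt (pow_lt_pow_right₀ h1 hd)
      rw [familyEval_apply, hw.add_eq_left_of_lt hlt, map_pow, hi]

/-- Integrality of c and of the inverse Vandermonde matrix gives both inequalities, the terms c_i^d
having absolute value at most 1. -/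
lemma affineMax_familyEval_eq_parameter (hw : IsNonarchimedean w) (hm : 2 ≤ m)
    (hG : G * revVandermonde c = 1) (hGA : ∀ i j, w (G i j) ≤ 1) (hcB : ∀ i, w (c i) ≤ 1)
    (t : Fin m → k) : affineMax w (familyEval d t c) = affineMax w t := by
  have hL := one_le_affineMax w t
  have hF := one_le_affineMax w (familyEval d t c)
  have hcd : ∀ i, w (c i ^ d) ≤ 1 := fun i ↦ by
    rw [map_pow]
    exact pow_le_one₀ (w.nonneg _) (hcB i)
  refine le_antisymm ((affineMax_le_iff _ _).2 ⟨hL, fun i ↦ ?_⟩)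
    ((affineMax_le_iff _ _).2 ⟨hF, fun j ↦ ?_⟩)
  · rw [familyEval_apply]
    refine (hw _ _).trans (max_le ((hcd i).trans hL) ?_)
    simpa using abv_lowerSum_le_of_isNonarchimedean hw (by omega) (c i) le_rfl (hcB i)
  · have : Nonempty (Fin m) := ⟨j⟩
    rw [parameter_eq hG d t j]
    obtain ⟨i, -, hi⟩ := hw.finset_image_add_of_nonempty
      (fun i ↦ G j i * (familyEval d t c i - c i ^ d)) Finset.univ_nonempty
    refine hi.trans ?_
    rw [map_mul]
    refine (mul_le_of_le_one_left (w.nonneg _) (hGA j i)).trans ?_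
    rw [sub_eq_add_neg]
    refine (hw _ _).trans (max_le (le_affineMax w _ i) ?_)
    rw [w.map_neg]
    exact (hcd i).trans hF

/-- At places of good reduction, the heights of the iterates are exact multiples of the height
of the parameter. -/
theorem orbitHeight_succ_of_isNonarchimedean (hw : IsNonarchimedean w) (hd : m < d) (hm : 2 ≤ m)
    (hG : G * revVandermonde c = 1) (hGA : ∀ i j, w (G i j) ≤ 1) (hcB : ∀ i, w (c i) ≤ 1)
    (t : Fin m → k) (n : ℕ) :
    orbitHeight w d t c (n + 1) = (d : ℝ) ^ n * Real.log (affineMax w t) := by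
  -- The first step produces |t| rather than |t|^d, hence the exponent d^n at index n + 1; this
  -- shift is the source of the factor 1/d in the theorem.
  have key : ∀ n, affineMax w ((familyEval d t)^[n + 1] c) = affineMax w t ^ (d ^ n) := fun n ↦ by
    induction n with
    | zero => simpa using affineMax_familyEval_eq_parameter hw hm hG hGA hcB t
    | succ n ih =>
      rw [Function.iterate_succ_apply', affineMax_familyEval_of_isNonarchimedean hw hd hm, ih,
        ← pow_mul, pow_succ]
      rw [ih]
      exact le_self_pow₀ (one_le_affineMax w t) (pow_ne_zero _ (by omega))
  rw [orbitHeight, key, Real.log_pow]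
  push_cast
  ring

end GoodPlaces

/-! ### From projective points to affine coordinates -/

section ProjectivePoints

variable {k : Type u} [Field k] {m : ℕ}

open Classical in
lemma normalizedCoords_affinePoint (a : Fin m → k) :
    normalizedCoords (affinePoint a) = Fin.cons 1 a := by
  obtain ⟨r, hr⟩ := (Projectivization.mk_eq_mk_iff' k (affinePoint a).rep (Fin.cons 1 a)
    (affinePoint a).rep_nonzero (cons_one_ne_zero a)).1 (affinePoint a).mk_rep
  have hr0 : r ≠ 0 := by
    rintro rfl
    exact (affinePoint a).rep_nonzero (by rw [← hr, zero_smul])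
  have h0 : (affinePoint a).rep 0 = r := by
    rw [← hr]
    simp
  have hfind :
      Fin.find (fun i ↦ (affinePoint a).rep i ≠ 0) (exists_rep_ne_zero (affinePoint a)) = 0 := by
    rw [Fin.find_eq_zero, h0]
    exact hr0
  rw [normalizedCoords, hfind, h0, ← hr, smul_smul, inv_mul_cancel₀ hr0, one_smul]

lemma familyMap_affinePoint {d : ℕ} (hd : m < d) (t a : Fin m → k) :
    familyMap hd t (affinePoint a) = affinePoint (familyEval d t a) := by
  refine (Projectivization.mk_eq_mk_iff' _ _ _ _ _).2 ⟨1, ?_⟩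
  rw [one_smul]
  funext i
  refine Fin.cases ?_ (fun j ↦ ?_) i
  · simp [liftedMap]
  · simp [liftedMap, familyHom, familyEval_apply]

lemma iterate_familyMap_affinePoint {d : ℕ} (hd : m < d) (t a : Fin m → k) (n : ℕ) :
    (familyMap hd t)^[n] (affinePoint a) = affinePoint ((familyEval d t)^[n] a) := by
  induction n with
  | zero => rfl
  | succ n ih => rw [Function.iterate_succ_apply', ih, familyMap_affinePoint,
      Function.iterate_succ_apply']

/-- The whole orbit stays in one field, so all its heights can be computed over the same finite
extension. -/
lemma familyEval_iterate_mem {K : Type*} [Field K] [Algebra K k] {E : IntermediateField K k}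
    {d : ℕ} {t a : Fin m → k} (ht : ∀ i, t i ∈ E) (ha : ∀ i, a i ∈ E) (n : ℕ) (i : Fin m) :
    (familyEval d t)^[n] a i ∈ E := by
  induction n generalizing i with
  | zero => exact ha i
  | succ n ih =>
    rw [Function.iterate_succ_apply', familyEval_apply]
    exact add_mem (pow_mem (ih i) d) (sum_mem fun j _ ↦ mul_mem (ht j) (pow_mem (ih i) _))

end ProjectivePoints

/-! ### Conjugates of the extended absolute values -/

section Conjugates

variable {K : Type u} {Kbar : Type v} [Field K] [Field Kbar] [Algebra K Kbar]

/-- The extension of `v` to the algebraic closure, precomposed with an endomorphism. -/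
noncomputable def conjAbs (v : AbsoluteValue K ℝ) (τ : Kbar →ₐ[K] Kbar) : AbsoluteValue Kbar ℝ :=
  (extendAbs K Kbar v).comp (f := (τ : Kbar →+* Kbar)) τ.injective

lemma conjAbs_apply (v : AbsoluteValue K ℝ) (τ : Kbar →ₐ[K] Kbar) (x : Kbar) :
    conjAbs v τ x = extendAbs K Kbar v (τ x) := rfl

/-- The second alternative covers the trivial default value. Either one suffices for integrality
arguments, so existence of an extension is never needed. -/
lemma extendAbs_algebraMap_or (v : AbsoluteValue K ℝ) :
    (∀ a, extendAbs K Kbar v (algebraMap K Kbar a) = v a) ∨ ∀ x, extendAbs K Kbar v x ≤ 1 := by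
  classical
  rw [extendAbs]
  split_ifs with h
  · exact Or.inl h.choose_spec
  · refine Or.inr fun x ↦ ?_
    by_cases hx : x = 0 <;> simp [hx]

/-- Being ultrametric is detected on the natural numbers, so it passes from `v` to any extension of
`v`. -/
lemma isNonarchimedean_of_natCast_le_one {k : Type*} [Field k] {w : AbsoluteValue k ℝ}
    (h : ∀ n : ℕ, w n ≤ 1) : IsNonarchimedean w := by
  have : IsUltrametricDist (WithAbs w) :=
    isUltrametricDist_iff_forall_norm_natCast_le_one.2 fun n ↦ h n
  intro x y
  exact IsUltrametricDist.isNonarchimedean_norm (WithAbs.toAbs w x) (WithAbs.toAbs w y)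

lemma isNonarchimedean_conjAbs {v : AbsoluteValue K ℝ} (hv : IsNonarchimedean v)
    (τ : Kbar →ₐ[K] Kbar) : IsNonarchimedean (conjAbs v τ) := by
  refine isNonarchimedean_of_natCast_le_one fun n ↦ ?_
  rw [conjAbs_apply, map_natCast]
  rcases extendAbs_algebraMap_or (Kbar := Kbar) v with h | h
  · rw [← map_natCast (algebraMap K Kbar), h]
    exact hv.apply_natCast_le_one
  · exact h _

/-- If w x > 1, the leading term of the monic relation would exceed every other term. -/
lemma abv_le_one_of_monic {k : Type*} [Field k] [Algebra K k] {w : AbsoluteValue k ℝ}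
    (hw : IsNonarchimedean w) {p : Polynomial K} (hp : p.Monic)
    (hc : ∀ i, w (algebraMap K k (p.coeff i)) ≤ 1) {x : k} (hx : Polynomial.aeval x p = 0) :
    w x ≤ 1 := by
  by_contra! h
  have h0 : p.natDegree ≠ 0 := by
    intro h0
    rw [Polynomial.natDegree_eq_zero_iff_degree_le_zero, hp.degree_le_zero_iff_eq_one] at h0
    simp [h0] at hx
  rw [Polynomial.aeval_eq_sum_range, Finset.sum_range_succ, hp.coeff_natDegree, one_smul] at hx
  have hne : (Finset.range p.natDegree).Nonempty := by simpa using h0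
  obtain ⟨i, hi, hle⟩ := hw.finset_image_add_of_nonempty (fun i ↦ p.coeff i • x ^ i) hne
  rw [eq_neg_of_add_eq_zero_left hx, w.map_neg, Algebra.smul_def, map_mul, map_pow, map_pow] at hle
  have h1 : w (algebraMap K k (p.coeff i)) * w x ^ i ≤ w x ^ i :=
    mul_le_of_le_one_left (by positivity) (hc i)
  exact absurd (hle.trans h1) (not_le.2 (pow_lt_pow_right₀ h (Finset.mem_range.1 hi)))

/-- Every τ sends y_i to a root of its minimal polynomial, so only finitely many values occur and
the bound is uniform in τ. -/
lemma exists_conjAbs_le [Algebra.IsAlgebraic K Kbar] {ι : Type*} [Finite ι]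
    (v : AbsoluteValue K ℝ) (y : ι → Kbar) : ∃ B, 1 ≤ B ∧ ∀ τ i, conjAbs v τ (y i) ≤ B := by
  have hfin : (⋃ i, (extendAbs K Kbar v) '' (minpoly K (y i)).rootSet Kbar).Finite :=
    Set.finite_iUnion fun i ↦ (Polynomial.rootSet_finite _ _).image _
  obtain ⟨B, hB⟩ := hfin.bddAbove
  refine ⟨max 1 B, le_max_left _ _, fun τ i ↦ le_max_of_le_right (hB ?_)⟩
  refine Set.mem_iUnion.2 ⟨i, τ (y i), ?_, rfl⟩
  refine Polynomial.mem_rootSet.2 ⟨minpoly.ne_zero (Algebra.IsIntegral.isIntegral _), ?_⟩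
  rw [Polynomial.aeval_algHom_apply, minpoly.aeval, map_zero]

open Height.AdmissibleAbsValues in
-- At almost all places every nonzero coefficient of the minimal polynomials has absolute value 1;
-- all conjugates are then integral at once.
lemma finite_setOf_not_conjAbs_le_one [Height.AdmissibleAbsValues K] [Algebra.IsAlgebraic K Kbar]
    {ι : Type*} [Finite ι] (y : ι → Kbar) :
    {v : nonarchAbsVal (K := K) | ¬ ∀ τ i, conjAbs v.val τ (y i) ≤ 1}.Finite := by
  have hfin : (⋃ i, ⋃ a ∈ ((minpoly K (y i)).coeffs : Set K),
      {v : nonarchAbsVal (K := K) | v.val a ≠ 1}).Finite := by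
    refine Set.finite_iUnion fun i ↦ Set.Finite.biUnion (Finset.finite_toSet _) fun a ha ↦ ?_
    exact hasFiniteMulSupport fun h0 ↦ by
      obtain ⟨n, hn, hna⟩ := Polynomial.mem_coeffs_iff.1 ha
      exact Polynomial.mem_support_iff.1 hn (hna.symm.trans h0)
  refine hfin.subset fun v hv ↦ ?_
  by_contra hcon
  refine hv fun τ i ↦ ?_
  have hint : IsIntegral K (y i) := Algebra.IsIntegral.isIntegral _
  refine abv_le_one_of_monic (isNonarchimedean_conjAbs (isNonarchimedean _ v.2) τ)
    (minpoly.monic hint) (fun j ↦ ?_) (minpoly.aeval K (y i))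
  rw [conjAbs_apply, AlgHom.commutes]
  rcases extendAbs_algebraMap_or (Kbar := Kbar) v.val with h | h
  · rw [h]
    by_cases h0 : (minpoly K (y i)).coeff j = 0
    · simp [h0]
    · by_contra! h1
      refine hcon (Set.mem_iUnion.2 ⟨i, Set.mem_biUnion (Polynomial.coeff_mem_coeffs h0) h1.ne'⟩)
  · exact h _

end Conjugates

/-! ### Weil heights as averages over embeddings of a common field -/

section AverageHeight

variable {K : Type u} {Kbar : Type v} [Field K] [Field Kbar] [Algebra K Kbar]

lemma card_embedding_pos (E : IntermediateField K Kbar) [FiniteDimensional K E] :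
    0 < Nat.card (E →ₐ[K] Kbar) :=
  Nat.card_pos_iff.2 ⟨⟨E.val⟩, inferInstance⟩

variable [Algebra.IsAlgebraic K Kbar] [IsAlgClosed Kbar] {m : ℕ}

lemma exists_extension_embedding (E : IntermediateField K Kbar) (σ : E →ₐ[K] Kbar) :
    ∃ τ : Kbar →ₐ[K] Kbar, ∀ x : E, τ x = σ x := by
  obtain ⟨τ, hτ⟩ := IsAlgClosed.surjective_domRestrict_of_isAlgebraic (K := K) (L := E)
    (M := Kbar) (E := Kbar) σ
  exact ⟨τ, fun x ↦ DFunLike.congr_fun hτ x⟩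

/-- A lift of an embedding to an endomorphism of the algebraic closure. -/
noncomputable def embLift (E : IntermediateField K Kbar) (σ : E →ₐ[K] Kbar) : Kbar →ₐ[K] Kbar :=
  (exists_extension_embedding E σ).choose

lemma embLift_apply (E : IntermediateField K Kbar) (σ : E →ₐ[K] Kbar) (x : E) :
    embLift E σ x = σ x := (exists_extension_embedding E σ).choose_spec x

/-- Averages over the embeddings of a field do not change when the field is enlarged. -/
lemma average_embedding_restrict {L E : IntermediateField K Kbar} (hLE : L ≤ E)
    [FiniteDimensional K E] (f : (L →ₐ[K] Kbar) → ℝ) :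
    (Nat.card (L →ₐ[K] Kbar) : ℝ)⁻¹ * ∑ᶠ σ, f σ =
      (Nat.card (E →ₐ[K] Kbar) : ℝ)⁻¹ *
        ∑ᶠ σ : E →ₐ[K] Kbar, f (σ.comp (IntermediateField.inclusion hLE)) := by
  classical
  let : Algebra L E := (IntermediateField.inclusion hLE).toAlgebra
  have : IsScalarTower K L E := IsScalarTower.of_algebraMap_eq fun _ ↦ rfl
  have : FiniteDimensional K L := FiniteDimensional.left K L E
  have : Algebra.IsAlgebraic L E := Algebra.IsAlgebraic.tower_top (K := K) L
  let := Fintype.ofFinite (L →ₐ[K] Kbar)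
  let := Fintype.ofFinite (E →ₐ[K] Kbar)
  -- Viewing `Kbar` as an `L`-algebra through σ turns the extensions of σ into `L`-embeddings of
  -- `E`. Their number is the separable degree, so no separability assumption is needed.
  have hfib : ∀ σ : L →ₐ[K] Kbar,
      (Finset.univ.filter fun ρ : E →ₐ[K] Kbar ↦
        ρ.comp (IntermediateField.inclusion hLE) = σ).card = Field.finSepDegree L E := fun σ ↦ by
    let : Algebra L Kbar := σ.toRingHom.toAlgebra
    rw [Field.finSepDegree_eq_of_isAlgClosed L E Kbar, ← Fintype.card_subtype,
      ← Nat.card_eq_fintype_card]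
    refine Nat.card_congr
      { toFun := fun ρ ↦ { ρ.1.toRingHom with commutes' := fun x ↦ DFunLike.congr_fun ρ.2 x }
        invFun := fun φ ↦ ⟨{ φ.toRingHom with commutes' := fun x ↦ ?_ }, ?_⟩
        left_inv := fun ρ ↦ rfl
        right_inv := fun φ ↦ rfl }
    · exact (φ.commutes (algebraMap K L x)).trans (σ.commutes x)
    · ext x
      exact φ.commutes x
  have hsum : ∑ σ : E →ₐ[K] Kbar, f (σ.comp (IntermediateField.inclusion hLE)) =
      Field.finSepDegree L E * ∑ σ, f σ := by
    rw [← Finset.sum_fiberwise (s := Finset.univ)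
      (g := fun ρ : E →ₐ[K] Kbar ↦ ρ.comp (IntermediateField.inclusion hLE)), Finset.mul_sum]
    refine Finset.sum_congr rfl fun σ _ ↦ ?_
    rw [Finset.sum_congr rfl fun ρ hρ ↦ by rw [(Finset.mem_filter.1 hρ).2], Finset.sum_const,
      hfib, nsmul_eq_mul]
  have hcard : Nat.card (E →ₐ[K] Kbar) = Field.finSepDegree L E * Nat.card (L →ₐ[K] Kbar) := by
    rw [Nat.card_eq_fintype_card, Nat.card_eq_fintype_card, ← Finset.card_univ,
      Finset.card_eq_sum_card_fiberwise (t := Finset.univ)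
        (f := fun ρ : E →ₐ[K] Kbar ↦ ρ.comp (IntermediateField.inclusion hLE))
        fun _ _ ↦ Finset.mem_coe.2 (Finset.mem_univ _), Finset.sum_congr rfl fun σ _ ↦ hfib σ,
        Finset.sum_const, smul_eq_mul, mul_comm, Finset.card_univ]
  have hE := card_embedding_pos E
  have hs : Field.finSepDegree L E ≠ 0 := by
    rintro h
    rw [hcard, h, zero_mul] at hE
    exact hE.false
  rw [finsum_eq_sum_of_fintype, finsum_eq_sum_of_fintype, hsum, hcard]
  push_cast
  have : (Field.finSepDegree L E : ℝ) ≠ 0 := by exact_mod_cast hs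
  field_simp

/-- The local height of an affine point at `v`, averaged over the embeddings of `E`. -/
noncomputable def averageHeight (E : IntermediateField K Kbar) (v : AbsoluteValue K ℝ)
    (a : Fin m → Kbar) : ℝ :=
  (Nat.card (E →ₐ[K] Kbar) : ℝ)⁻¹ *
    ∑ᶠ σ : E →ₐ[K] Kbar, Real.log (affineMax (conjAbs v (embLift E σ)) a)

open Height.AdmissibleAbsValues in
-- Invariance of averages lets any finite extension containing the coordinates replace the field
-- they generate, so the parameter and the whole orbit can share one `E`.
theorem weilHeight_affinePoint [Height.AdmissibleAbsValues K] (E : IntermediateField K Kbar)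
    [FiniteDimensional K E] {a : Fin m → Kbar} (ha : ∀ i, a i ∈ E) :
    weilHeight K (affinePoint a) =
      ((archAbsVal (K := K)).map fun v ↦ averageHeight E v a).sum +
        ∑ᶠ v : nonarchAbsVal (K := K), averageHeight E v.val a := by
  have hLE : fieldOf K (Fin.cons 1 a : Fin (m + 1) → Kbar) ≤ E := by
    refine IntermediateField.adjoin_le_iff.2 ?_
    rintro _ ⟨i, rfl⟩
    refine Fin.cases ?_ (fun j ↦ ?_) i
    · simp
    · simpa using ha j
  have hloc : ∀ v : AbsoluteValue K ℝ,
      (Nat.card (fieldOf K (Fin.cons 1 a : Fin (m + 1) → Kbar) →ₐ[K] Kbar) : ℝ)⁻¹ *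
        localHeight (fieldOf K (Fin.cons 1 a : Fin (m + 1) → Kbar)) (fun i ↦
          ⟨(Fin.cons 1 a : Fin (m + 1) → Kbar) i, IntermediateField.subset_adjoin K _ ⟨i, rfl⟩⟩) v =
      averageHeight E v a := fun v ↦ by
    rw [localHeight, average_embedding_restrict hLE, averageHeight]
    congr 1
    refine finsum_congr fun σ ↦ ?_
    rw [affineMax]
    congr 1
    refine iSup_congr fun i ↦ ?_
    rw [conjAbs_apply]
    congr 1
    exact (embLift_apply E σ (IntermediateField.inclusion hLE _)).symm
  rw [weilHeight, normalizedCoords_affinePoint, weilHeightTuple, weilHeightOver, mul_add,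
    ← Multiset.sum_map_mul_left, ← smul_eq_mul (b := finsum _), smul_finsum]
  simp only [smul_eq_mul, hloc]

end AverageHeight

/-! ### The generic fibre -/

section Generic

variable {F : Type u} [Field F] {m : ℕ}

lemma canonicalHeightConverges_and_eq {X : Type u} {h : X → ℝ} {d : ℕ} {f : X → X} {x : X} {l : ℝ}
    (hl : Tendsto (fun n : ℕ ↦ h (f^[n] x) / (d : ℝ) ^ n) atTop (𝓝 l)) :
    CanonicalHeightConverges h d f x ∧ canonicalHeight h d f x = l := by
  have : canonicalHeight h d f x = l := hl.limUnder_eq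
  exact ⟨by rwa [CanonicalHeightConverges, this], this⟩

lemma divisorAbs_C_le_one {v : AbsoluteValue (RationalFunctions F (Fin m)) ℝ}
    (hv : v ∈ divisorAbs F (Fin m)) (a : F) :
    v (algebraMap (MvPolynomial (Fin m) F) _ (MvPolynomial.C a)) ≤ 1 := by
  rcases eq_or_ne a 0 with rfl | ha
  · simp
  have hC : (MvPolynomial.C a : MvPolynomial (Fin m) F) ≠ 0 := by simpa using ha
  rcases hv with rfl | ⟨p, hp, rfl⟩
  · rw [inftyAbs_algebraMap hC]
    simp
  · rw [primeAbs_algebraMap hp hC, Real.exp_le_one_iff]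
    have : (0 : ℝ) ≤ p.totalDegree * multiplicity p (MvPolynomial.C a) := by positivity
    linarith

lemma affineMax_genericParameter_infty (hm : 0 < m) :
    affineMax (inftyAbs F (Fin m)) (genericParameter F m) = Real.exp 1 := by
  have h : ∀ i, inftyAbs F (Fin m) (genericParameter F m i) = Real.exp 1 := fun i ↦ by
    rw [genericParameter, inftyAbs_algebraMap (MvPolynomial.X_ne_zero i)]
    simp
  refine le_antisymm ((affineMax_le_iff _ _).2 ⟨Real.one_le_exp zero_le_one, fun i ↦ (h i).le⟩) ?_
  rw [← h ⟨0, hm⟩]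
  exact le_affineMax _ _ _

lemma affineMax_genericParameter_prime {p : MvPolynomial (Fin m) F} (hp : Irreducible p) :
    affineMax (primeAbs p hp) (genericParameter F m) = 1 := by
  refine le_antisymm ((affineMax_le_iff _ _).2 ⟨le_rfl, fun i ↦ ?_⟩) (one_le_affineMax _ _)
  rw [genericParameter, primeAbs_algebraMap hp (MvPolynomial.X_ne_zero i), Real.exp_le_one_iff]
  have : (0 : ℝ) ≤ p.totalDegree * multiplicity p (MvPolynomial.X i) := by positivity
  linarith

lemma isNonarchimedean_of_mem_divisorAbs {v : AbsoluteValue (RationalFunctions F (Fin m)) ℝ}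
    (hv : v ∈ divisorAbs F (Fin m)) : IsNonarchimedean v :=
  rationalFunctionsAbsValues.isNonarchimedean v hv

/-- The c_i and the inverse Vandermonde entries are constants, hence integral at every prime divisor
and at infinity: all places are good. -/
lemma orbitHeight_generic {d : ℕ} (hd : m < d) (hm : 2 ≤ m) {c : Fin m → F}
    (hc : Function.Injective c) {v : AbsoluteValue (RationalFunctions F (Fin m)) ℝ}
    (hv : v ∈ divisorAbs F (Fin m)) (n : ℕ) :
    orbitHeight v d (genericParameter F m) (constantPoint c) (n + 1) =
      (d : ℝ) ^ n * Real.log (affineMax v (genericParameter F m)) := by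
  obtain ⟨G, hG⟩ := exists_mul_revVandermonde hc
  let φ : F →+* RationalFunctions F (Fin m) :=
    (algebraMap (MvPolynomial (Fin m) F) _).comp MvPolynomial.C
  have hG' : φ.mapMatrix G * revVandermonde (constantPoint c) = 1 := by
    have : revVandermonde (constantPoint c) = φ.mapMatrix (revVandermonde c) := by
      ext i j
      simp [revVandermonde, constantPoint, φ]
    rw [this, ← map_mul, hG, map_one]
  exact orbitHeight_succ_of_isNonarchimedean (isNonarchimedean_of_mem_divisorAbs hv) hd hm hG'
    (fun i j ↦ divisorAbs_C_le_one hv _) (fun i ↦ divisorAbs_C_le_one hv _) _ n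

/-- Without finite poles, only the hyperplane at infinity contributes. -/
lemma logHeight_affinePoint_eq {a : Fin m → RationalFunctions F (Fin m)}
    (ha : ∀ (p : MvPolynomial (Fin m) F) (hp : Irreducible p), affineMax (primeAbs p hp) a = 1) :
    Projectivization.logHeight (affinePoint a) =
      Real.log (affineMax (inftyAbs F (Fin m)) a) := by
  rw [affinePoint, Projectivization.logHeight_mk, Height.logHeight,
    Height.mulHeight_eq (cons_one_ne_zero a)]
  have h0 : (Height.AdmissibleAbsValues.archAbsVal (K := RationalFunctions F (Fin m))) = 0 := rfl
  rw [h0, Multiset.map_zero, Multiset.prod_zero, one_mul]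
  change Real.log (∏ᶠ v : divisorAbs F (Fin m), affineMax v.val a) = _
  rw [finprod_eq_single _ (⟨_, inftyAbs_mem⟩ : divisorAbs F (Fin m))]
  rintro ⟨v, rfl | ⟨p, hp, rfl⟩⟩ hv
  · exact absurd rfl hv
  · exact ha p hp

/-- The canonical height of the generic fibre is `1 / d`. -/
theorem tendsto_generic {d : ℕ} (hd : m < d) (hm : 2 ≤ m) {c : Fin m → F}
    (hc : Function.Injective c) :
    Tendsto (fun n : ℕ ↦ Projectivization.logHeight ((familyMap hd (genericParameter F m))^[n]
      (affinePoint (constantPoint c))) / (d : ℝ) ^ n) atTop (𝓝 (1 / d)) := by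
  have hd0 : (d : ℝ) ≠ 0 := by exact_mod_cast (show d ≠ 0 by omega)
  -- From index 1 on the sequence is constant, equal to d^n / d^(n+1).
  rw [← tendsto_add_atTop_iff_nat 1]
  refine tendsto_const_nhds.congr fun n ↦ ?_
  rw [iterate_familyMap_affinePoint, logHeight_affinePoint_eq fun p hp ↦ ?_]
  · change _ = orbitHeight (inftyAbs F (Fin m)) _ _ _ (n + 1) / _
    rw [orbitHeight_generic hd hm hc inftyAbs_mem, affineMax_genericParameter_infty (by omega),
      Real.log_exp]
    field_simp
    ring
  · have h := orbitHeight_generic hd hm hc (primeAbs_mem p hp) n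
    rw [affineMax_genericParameter_prime, Real.log_one, mul_zero, orbitHeight] at h
    exact Real.eq_one_of_pos_of_log_eq_zero (affineMax_pos _ _) h

end Generic

/-! ### Summing the local estimates over all places -/

section Specialization

variable {K : Type u} {Kbar : Type v} [Field K] [Field Kbar] [Algebra K Kbar]
  [Algebra.IsAlgebraic K Kbar] {m : ℕ}

open Height.AdmissibleAbsValues in
/-- The error terms at the places of `K`: they are independent of the degree and the parameter,
and vanish at almost all nonarchimedean places. -/
lemma exists_localBounds [Height.AdmissibleAbsValues K] (hm : 2 ≤ m) {c : Fin m → Kbar}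
    (hc : Function.Injective c) :
    ∃ C : AbsoluteValue K ℝ → ℝ, ∃ S : Set (nonarchAbsVal (K := K)), S.Finite ∧
      (∀ v ∉ S, C v.val = 0) ∧
      (∀ v ∉ S, ∀ (d : ℕ), m < d → ∀ (t : Fin m → Kbar) τ,
        affineMax (conjAbs v.val τ) t = 1 → ∀ n, orbitHeight (conjAbs v.val τ) d t c n = 0) ∧
      ∀ v (d : ℕ), m < d → ∀ (t : Fin m → Kbar) τ (l : ℝ),
        Tendsto (fun n ↦ orbitHeight (conjAbs v τ) d t c n / (d : ℝ) ^ n) atTop (𝓝 l) →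
          |l - Real.log (affineMax (conjAbs v τ) t) / d| ≤ C v := by
  classical
  obtain ⟨G, hG⟩ := exists_mul_revVandermonde hc
  -- Bundling the inverse matrix with c lets one bound serve as both A and B, and one integrality
  -- condition define the good places.
  let y : (Fin m × Fin m) ⊕ Fin m → Kbar := Sum.elim (fun p ↦ G p.1 p.2) c
  choose B hB1 hB using fun v : AbsoluteValue K ℝ ↦ exists_conjAbs_le v y
  let good : AbsoluteValue K ℝ → Prop := fun v ↦
    IsNonarchimedean v ∧ ∀ (τ : Kbar →ₐ[K] Kbar) i, conjAbs v τ (y i) ≤ 1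
  have hgood : ∀ v, good v → ∀ (d : ℕ), m < d → ∀ (t : Fin m → Kbar) τ n,
      orbitHeight (conjAbs v τ) d t c (n + 1) =
        (d : ℝ) ^ n * Real.log (affineMax (conjAbs v τ) t) := fun v hv d hd t τ n ↦
    orbitHeight_succ_of_isNonarchimedean (isNonarchimedean_conjAbs hv.1 τ) hd hm hG
      (fun i j ↦ hv.2 τ (Sum.inl (i, j))) (fun i ↦ hv.2 τ (Sum.inr i)) t n
  have hS : ∀ v : nonarchAbsVal (K := K), v ∉
      {v : nonarchAbsVal (K := K) | ¬ ∀ τ i, conjAbs v.val τ (y i) ≤ 1} → good v.val :=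
    fun v hv ↦ ⟨isNonarchimedean _ v.2, not_not.1 hv⟩
  refine ⟨fun v ↦ if good v then 0 else localBound m (B v) (B v), _,
    finite_setOf_not_conjAbs_le_one y, fun v hv ↦ if_pos (hS v hv), ?_, ?_⟩
  · intro v hv d hd t τ ht n
    cases n with
    | zero =>
      have : affineMax (conjAbs v.val τ) c = 1 := le_antisymm
        ((affineMax_le_iff _ _).2 ⟨le_rfl, fun i ↦ (hS v hv).2 τ (Sum.inr i)⟩) (one_le_affineMax _ _)
      rw [orbitHeight_zero, this, Real.log_one]
    | succ n => rw [hgood _ (hS v hv) d hd, ht, Real.log_one, mul_zero]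
  · intro v d hd t τ l hl
    by_cases hv : good v
    · have hd0 : (d : ℝ) ≠ 0 := by exact_mod_cast (show d ≠ 0 by omega)
      have : l = Real.log (affineMax (conjAbs v τ) t) / d := by
        refine tendsto_nhds_unique ((tendsto_add_atTop_iff_nat 1).2 hl)
          (tendsto_const_nhds.congr fun n ↦ ?_)
        rw [hgood v hv d hd]
        field_simp
        ring
      simp [hv, this]
    · simp only [hv, if_false]
      exact abs_sub_le_localBound (hB1 v) (hB1 v) hd hm hG (fun i j ↦ hB v τ (Sum.inl (i, j)))
        (fun i ↦ hB v τ (Sum.inr i)) t hl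

variable [IsAlgClosed Kbar]

/-- The averaged local heights converge along the orbit, and the limit is within `C` of the
averaged local height of the parameter if this holds for each conjugate absolute value. -/
lemma exists_tendsto_averageHeight {d : ℕ} (hd : m < d) (hm : 2 ≤ m)
    (E : IntermediateField K Kbar) [FiniteDimensional K E] (v : AbsoluteValue K ℝ)
    (t c : Fin m → Kbar) {C : ℝ}
    (hC : ∀ (τ : Kbar →ₐ[K] Kbar) (l : ℝ),
      Tendsto (fun n ↦ orbitHeight (conjAbs v τ) d t c n / (d : ℝ) ^ n) atTop (𝓝 l) →
        |l - Real.log (affineMax (conjAbs v τ) t) / d| ≤ C) :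
    ∃ l, Tendsto (fun n ↦ averageHeight E v ((familyEval d t)^[n] c) / (d : ℝ) ^ n) atTop (𝓝 l) ∧
      |l - averageHeight E v t / d| ≤ C := by
  let := Fintype.ofFinite (E →ₐ[K] Kbar)
  choose l hl using fun σ : E →ₐ[K] Kbar ↦
    exists_tendsto_orbitHeight (conjAbs v (embLift E σ)) hd hm t c
  have hN : (0 : ℝ) < Nat.card (E →ₐ[K] Kbar) := by exact_mod_cast card_embedding_pos E
  refine ⟨(Nat.card (E →ₐ[K] Kbar) : ℝ)⁻¹ * ∑ σ, l σ, ?_, ?_⟩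
  · refine ((tendsto_finsetSum Finset.univ fun σ _ ↦ hl σ).const_mul
      (Nat.card (E →ₐ[K] Kbar) : ℝ)⁻¹).congr fun n ↦ ?_
    rw [averageHeight, finsum_eq_sum_of_fintype, mul_div_assoc, Finset.sum_div]
    rfl
  · rw [averageHeight, finsum_eq_sum_of_fintype, mul_div_assoc, ← mul_sub, Finset.sum_div,
      ← Finset.sum_sub_distrib, abs_mul, abs_of_pos (inv_pos.2 hN), inv_mul_le_iff₀ hN]
    refine (Finset.abs_sum_le_sum_abs _ _).trans ((Finset.sum_le_sum fun σ _ ↦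
      hC (embLift E σ) _ (hl σ)).trans_eq ?_)
    simp

lemma averageHeight_eq_zero (E : IntermediateField K Kbar) {v : AbsoluteValue K ℝ}
    {a : Fin m → Kbar} (h : ∀ τ : Kbar →ₐ[K] Kbar, Real.log (affineMax (conjAbs v τ) a) = 0) :
    averageHeight E v a = 0 := by
  simp [averageHeight, h]

open Height.AdmissibleAbsValues in
-- For fixed t only finitely many nonarchimedean places contribute to any iterate, so limit and sum
-- commute. That set depends on t, but the error terms vanish off the t-independent `S`, so their
-- sum is a uniform constant.
theorem exists_tendsto_weilHeight [Height.AdmissibleAbsValues K] (hm : 2 ≤ m) {c : Fin m → Kbar}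
    (hc : Function.Injective c) :
    ∃ C : ℝ, ∀ (d : ℕ) (hd : m < d) (t : Fin m → Kbar), ∃ l,
      Tendsto (fun n : ℕ ↦ weilHeight K ((familyMap hd t)^[n] (affinePoint c)) / (d : ℝ) ^ n)
        atTop (𝓝 l) ∧ |l - weilHeight K (affinePoint t) / d| ≤ C := by
  classical
  obtain ⟨C, S, hSfin, hCS, hS, hC⟩ := exists_localBounds (K := K) hm hc
  refine ⟨((archAbsVal (K := K)).map C).sum + ∑ᶠ v : nonarchAbsVal (K := K), C v.val,
    fun d hd t ↦ ?_⟩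
  let E := IntermediateField.adjoin K (Set.range t ∪ Set.range c)
  have : FiniteDimensional K E :=
    IntermediateField.finiteDimensional_adjoin fun x _ ↦ Algebra.IsIntegral.isIntegral x
  have htE : ∀ i, t i ∈ E := fun i ↦
    IntermediateField.subset_adjoin K _ (Set.mem_union_left _ ⟨i, rfl⟩)
  have hcE : ∀ i, c i ∈ E := fun i ↦
    IntermediateField.subset_adjoin K _ (Set.mem_union_right _ ⟨i, rfl⟩)
  choose l hl hlC using fun v : AbsoluteValue K ℝ ↦
    exists_tendsto_averageHeight hd hm E v t c (hC v d hd t)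
  -- Off `T` the place is good and t is integral, so the parameter and every iterate, including the
  -- zeroth, have local height zero.
  let T := (hSfin.union (finite_setOf_not_conjAbs_le_one (K := K) t)).toFinset
  have hT : ∀ v ∉ T, v ∉ S ∧ ∀ τ, affineMax (conjAbs v.val τ) t = 1 := fun v hv ↦ by
    simp only [T, Set.Finite.mem_toFinset, Set.mem_union, not_or, Set.mem_ofPred_eq, not_not] at hv
    exact ⟨hv.1, fun τ ↦ le_antisymm ((affineMax_le_iff _ _).2 ⟨le_rfl, hv.2 τ⟩)
      (one_le_affineMax _ _)⟩
  have hsum : ∀ f : AbsoluteValue K ℝ → ℝ, (∀ v ∉ T, f v.val = 0) →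
      ∑ᶠ v : nonarchAbsVal (K := K), f v.val = ∑ v ∈ T, f v.val := fun f hf ↦
    finsum_eq_sum_of_support_subset _ fun v hv ↦ by
      by_contra h
      exact hv (hf v h)
  refine ⟨((archAbsVal (K := K)).map l).sum + ∑ v ∈ T, l v.val, ?_, ?_⟩
  · refine ((tendsto_multiset_sum _ fun v _ ↦ hl v).add
      (tendsto_finsetSum T fun v _ ↦ hl v.val)).congr fun n ↦ ?_
    rw [iterate_familyMap_affinePoint, weilHeight_affinePoint E
      fun i ↦ familyEval_iterate_mem htE hcE n i, hsum (fun v ↦ averageHeight E v _) fun v hv ↦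
        averageHeight_eq_zero E fun τ ↦ hS v (hT v hv).1 d hd t τ ((hT v hv).2 τ) n, add_div,
      Finset.sum_div, Multiset.sum_map_div]
  · rw [weilHeight_affinePoint E htE, hsum (fun v ↦ averageHeight E v t) fun v hv ↦
        averageHeight_eq_zero E fun τ ↦ by rw [(hT v hv).2 τ, Real.log_one],
      hsum C fun v hv ↦ hCS v (hT v hv).1, add_div, Finset.sum_div, ← Multiset.sum_map_div,
      add_sub_add_comm, ← Finset.sum_sub_distrib, ← Multiset.sum_map_sub]
    refine (abs_add_le _ _).trans (add_le_add ?_ ?_)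
    · refine (Multiset.abs_sum_le_sum_abs).trans ?_
      rw [Multiset.map_map]
      exact Multiset.sum_map_le_sum_map _ _ fun v _ ↦ hlC v
    · exact (Finset.abs_sum_le_sum_abs _ _).trans (Finset.sum_le_sum fun v _ ↦ hlC v.val)

end Specialization

end SpecializationHeight

open SpecializationHeight in
theorem mainTheorem3 {K : Type u} {Kbar : Type v} [Field K] [Height.AdmissibleAbsValues K]
    [Field Kbar] [Algebra K Kbar] [IsAlgClosure K Kbar]
    {m : ℕ} (hm : 2 ≤ m) (c : Fin m → Kbar) (hc : Function.Injective c) :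
    ∃ C : ℝ, ∀ (d : ℕ) (hd : m < d),
      CanonicalHeightConverges Projectivization.logHeight d
        (familyMap hd (genericParameter Kbar m)) (affinePoint (constantPoint c)) ∧
      ∀ lam : Fin m → Kbar,
        CanonicalHeightConverges (weilHeight K) d (familyMap hd lam) (affinePoint c) ∧
        |canonicalHeight (weilHeight K) d (familyMap hd lam) (affinePoint c) -
          canonicalHeight Projectivization.logHeight d
              (familyMap hd (genericParameter Kbar m)) (affinePoint (constantPoint c)) *
            weilHeight K (affinePoint lam)| ≤ C := by
  have := IsAlgClosure.isAlgClosed K (K := Kbar)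
  have := IsAlgClosure.isAlgebraic (R := K) (K := Kbar)
  obtain ⟨C, hC⟩ := exists_tendsto_weilHeight (K := K) hm hc
  refine ⟨C, fun d hd ↦ ?_⟩
  obtain ⟨hgen, hgen'⟩ := canonicalHeightConverges_and_eq (tendsto_generic hd hm hc)
  refine ⟨hgen, fun lam ↦ ?_⟩
  obtain ⟨l, hl, hlC⟩ := hC d hd lam
  obtain ⟨hsp, hsp'⟩ := canonicalHeightConverges_and_eq hl
  refine ⟨hsp, ?_⟩
  rwa [hsp', hgen', one_div, inv_mul_eq_div]
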